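/- A conjunctive query (CQ) is a rule $q\colon ans(\bar x)\leftarrow r_1(\bar x_1)\wedge\dots\wedge r_n(\bar x_n)$, where $\bar x,\bar x_i$ are finite lists of variables and constants (constants and database values are taken from a fixed countably infinite domain) and every variable of the head $\bar x$ occurs in the body. A database $D$ consists of finitely many facts $r(\bar a)$; its universe $U$ is the set of values occurring in them. The answer $q(D)$ is the set of all tuples $\bar x\sigma$, where $\sigma\colon vars(q)\to U$ is such that each $r_i(\bar x_i)\sigma$ is a fact of $D$. Two CQs are equivalent if they have the same answer on every database; a core of $q$ is a CQ equivalent to $q$ with the minimal number of atoms. For CQs with the same head, a homomorphism $q_1\to q_2$ is a map $f\colon vars(q_1)\to vars(q_2)\cup constants$ that fixes all variables of the head and maps every atom of $q_1$ to an atom of $q_2$ (constants being fixed); write $q_1\simeq q_2$ if there are homomorphisms in both directions. The fractional cover number $\rho^*(q)$ is the minimum of $\sum_e x_e$ over all $(x_e)_e$ with $x_e\ge 0$ and $\sum_{e\ni v}x_e\ge 1$ for every variable $v$ of $q$, where $e$ ranges over the distinct sets of variables occurring in the individual atoms of $q$. The semantic fractional cover number of $q$ is $\inf\{\rho^*(q')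 : q'\simeq q\}$. **Corollary.** Let $\mathcal Q$ be a class of CQs whose cores are computable in polynomial time, i.e. some polynomial-time Turing machine outputs, for each $q\in\mathcal Q$, a core of $q$. If there is a constant $k$ such that every $q\in\mathcal Q$ has semantic fractional cover number at most $k$, then the queries in $\mathcal Q$ can be evaluated in polynomial time: there is a Turing machine that, given any $q\in\mathcal Q$ and any database $D$, outputs $q(D)$ (as a list of tuples without repetitions) in time polynomial in the joint size of $q$ and $D$. -/

import Mathlib

open scoped Hypergraph

/-! ### Databases and conjunctive queries -/

/-- A relation name applied to a list of arguments. Names are natural numbers; the same name used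
with different numbers of arguments counts as different relation symbols. -/
structure RelAtom (T : Type) where
  rel : ℕ
  args : List T
deriving DecidableEq

/-- Apply a map to all arguments of an atom. -/
def RelAtom.map {S T : Type} (f : S → T) (a : RelAtom S) : RelAtom T :=
  ⟨a.rel, a.args.map f⟩

/-- A fact (tuple of a relation instance). The attribute values form a fixed countably infinite
domain, here `ℕ`. -/
abbrev DBFact : Type := RelAtom ℕ

/-- A database instance: finitely many facts, i.e. a finite set of tuples for every relation name
(empty for all but finitely many names). -/
abbrev Database : Type := Finset DBFact

/-- The universe of a database: all values occurring in its relation instances. -/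
def Database.universe (D : Database) : Set ℕ := {u | ∃ a ∈ D, u ∈ a.args}

/-- A term is a variable or a constant (an element of the domain). -/
inductive Term : Type
  | var (x : ℕ)
  | const (c : ℕ)
deriving DecidableEq

/-- The value of a term under a substitution of values for variables. -/
def Term.eval (σ : ℕ → ℕ) : Term → ℕ
  | .var x => σ x
  | .const c => c

/-- Replace variables by terms. -/
def Term.subst (f : ℕ → Term) : Term → Term
  | .var x => f x
  | .const c => .const c

/-- The variables occurring in a list of terms. -/
def varsOf (l : List Term) : Set ℕ := {x | Term.var x ∈ l}

/-- A conjunctive query `ans(head) ← body₁ ∧ ⋯ ∧ bodyₙ`. As usual for rule based queries, it is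
safe: every variable of the head occurs in the body. -/
structure CQ where
  head : List Term
  body : List (RelAtom Term)
  safe : ∀ x ∈ varsOf head, ∃ a ∈ body, x ∈ varsOf a.args

namespace CQ

/-- The set of atoms in the body. -/
def atoms (q : CQ) : Finset (RelAtom Term) := q.body.toFinset

/-- The variables of a query (those of the head occur in the body). -/
def vars (q : CQ) : Set ℕ := {x | ∃ a ∈ q.atoms, x ∈ varsOf a.args}

/-- The answer of a query on a database with universe `U`: all tuples `head σ`, where the
substitution `σ : vars q → U` turns every atom into a fact of the database. -/
def answer (q : CQ) (D : Database) : Set (List ℕ) :=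
  {t | ∃ σ : ℕ → ℕ, (∀ x ∈ q.vars, σ x ∈ D.universe) ∧
    (∀ a ∈ q.atoms, a.map (Term.eval σ) ∈ D) ∧ t = q.head.map (Term.eval σ)}

/-- Two queries are equivalent if they have the same answer over every database. -/
def Equivalent (q q' : CQ) : Prop := ∀ D : Database, q.answer D = q'.answer D

/-- `c` is a core of `q`: it is equivalent to `q` with the least possible number of atoms. -/
def IsCore (c q : CQ) : Prop :=
  Equivalent c q ∧ ∀ q' : CQ, Equivalent q' q → c.atoms.card ≤ q'.atoms.card

/-- `f` is a homomorphism from `q₁` to `q₂` (queries with the same head): it maps variables to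
variables or constants, fixes the variables of the head and maps atoms to atoms. -/
def IsHom (q₁ q₂ : CQ) (f : ℕ → Term) : Prop :=
  q₁.head = q₂.head ∧ (∀ x ∈ varsOf q₁.head, f x = Term.var x) ∧
    ∀ a ∈ q₁.atoms, a.map (Term.subst f) ∈ q₂.atoms

/-- Homomorphic equivalence `q₁ ≃ q₂`. -/
def HomEquiv (q₁ q₂ : CQ) : Prop := (∃ f, IsHom q₁ q₂ f) ∧ ∃ g, IsHom q₂ q₁ g

/-- The hypergraph of a query: its vertices are the variables, and each atom gives the hyperedge
of the variables occurring in it. -/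
def hypergraph (q : CQ) : Hypergraph ℕ where
  vertexSet := q.vars
  edgeSet := {e | ∃ a ∈ q.atoms, e = varsOf a.args}
  subset_vertexSet_of_mem_edgeSet' := by
    rintro e ⟨a, ha, rfl⟩ x hx
    exact ⟨a, ha, hx⟩

end CQ

/-! ### Fractional edge covers -/

/-- `x` is a fractional edge cover of (the vertex set of) the finite hypergraph `H`. -/
def IsFractionalEdgeCover {α : Type} (H : Hypergraph α) (x : Set α → ℝ) : Prop :=
  (∀ e ∈ E(H), 0 ≤ x e) ∧ ∀ v ∈ V(H), 1 ≤ ∑ᶠ e ∈ {e | e ∈ E(H) ∧ v ∈ e}, x e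

/-- The fractional edge cover number `ρ*(H)` of a finite hypergraph: the least total weight of a
fractional edge cover. -/
noncomputable def fractionalCoverNumber {α : Type} (H : Hypergraph α) : ℝ :=
  sInf {w | ∃ x : Set α → ℝ, IsFractionalEdgeCover H x ∧ w = ∑ᶠ e ∈ E(H), x e}

namespace CQ

/-- The fractional cover number `ρ*(q)` of a query is that of its hypergraph. -/
noncomputable def rhoStar (q : CQ) : ℝ := fractionalCoverNumber q.hypergraph

/-- The semantic variant of `w`: `inf {w q' | q' ≃ q}`. -/
noncomputable def semantic (w : CQ → ℝ) (q : CQ) : ℝ := sInf {r | ∃ q', HomEquiv q' q ∧ r = w q'}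

end CQ

/-! ### Encodings as strings over a finite alphabet -/

/-- The alphabet. -/
inductive Token : Type
  | bit (b : Bool)
  | var
  | const
  | lpar
  | rpar
  | sep
deriving DecidableEq

/-- Natural numbers are written in binary. -/
def encNat (n : ℕ) : List Token := (Computability.encodeNat n).map Token.bit

def encTerm : Term → List Token
  | .var x => Token.var :: encNat x
  | .const c => Token.const :: encNat c

/-- A list of terms, in parentheses. -/
def encTerms (l : List Term) : List Token := Token.lpar :: (l.flatMap encTerm ++ [Token.rpar])

/-- A relation name followed by the list of its arguments. -/
def encAtom (a : RelAtom Term) : List Token := encNat a.rel ++ encTerms a.args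

/-- A query: the head, then the atoms. -/
def encCQ (q : CQ) : List Token := encTerms q.head ++ q.body.flatMap encAtom

/-- A tuple of values. -/
def encTuple (t : List ℕ) : List Token := encTerms (t.map Term.const)

/-- A relation, given as a list of tuples. -/
def encRelation (A : List (List ℕ)) : List Token := A.flatMap encTuple

/-- A database, given as a list of facts. -/
def encFacts (L : List DBFact) : List Token := L.flatMap fun a => encAtom (a.map Term.const)

/-- A query together with a database. -/
def encInput (q : CQ) (L : List DBFact) : List Token := encCQ q ++ Token.sep :: encFacts L

/-! ### Polynomial time -/

/-- The search problem `R` on the instances `α` is solvable in polynomial time: a Turing machine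
computes from the string `ea a`, in time polynomial in the length of this string, the string `eb b`
for some solution `b` of `a`. Nothing is required on strings that do not encode an instance. -/
def PolyTimeSolvable {α β αΓ βΓ : Type} (ea : α → List αΓ) (eb : β → List βΓ)
    (R : α → β → Prop) : Prop :=
  ∃ f : α → β, (∀ a, R a (f a)) ∧ Nonempty (Turing.TM2ComputableInPolyTime ea eb f)

/-- For the queries of the class `Q`, a core is computable in polynomial time. -/
def CoresComputableInPolyTime (Q : Set CQ) : Prop :=
  PolyTimeSolvable (fun q : Q => encCQ q) encCQ fun q c => CQ.IsCore c q

/-- The queries of the class `Q` can be evaluated in time polynomial in the joint size of the query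
and the database: on input of `q ∈ Q` and a list of the facts of a database `D` (in any order), a
Turing machine outputs a list without repetitions of the tuples in the answer of `q` on `D`. -/
def EvaluableInPolyTime (Q : Set CQ) : Prop :=
  PolyTimeSolvable (fun p : Q × List DBFact => encInput p.1 p.2) encRelation
    fun p A => A.Nodup ∧ ∀ t, t ∈ A ↔ t ∈ CQ.answer p.1 p.2.toFinset

/-!
The class is evaluated by computing a core `c` of the query and then joining its atoms variable by
variable.

*The algorithm* (`PolyTM.answerList`). After round `n` there is a list of all instances of `c` in
which the first `n` variables have been replaced by values of the database and in which every atom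
still agrees with some fact, up to its remaining variables. After the last round the heads of these
instances are the answer (`PolyTM.mem_answerList`). Every round takes time polynomial in the length
of the current list, so it suffices that the lists stay short.

*The lists stay short* (`PolyTM.length_instances_le`). A query `q'` that is homomorphically
equivalent to the given query and has a fractional edge cover of weight less than `k + 1` exists by
hypothesis. The core is a retract of `q'` (`CQ.IsCore.exists_retract`): equivalence gives
homomorphisms in both directions (Chandra and Merlin, `CQ.exists_headHom`), and the resulting
endomorphism of the core permutes its atoms by minimality, so that some power of it is the identity.
The edge cover of `q'` can therefore be pulled back to the core, and to any subset of its variables.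
As one fact determines the values of all variables in an edge, the bound of Atserias, Grohe and Marx
(`PolyTM.numRestrict_le_prod`, an induction on the variables with Hölder's inequality) shows that
there are at most `(|D| + 1) ^ ⌈k + 1⌉` instances.

*The machine.* `PolyTM.PT u v` says that some machine transforms the string `u i` into `v i` for all
indices `i` in polynomial time. It is built from four constructions on stack machines: composition,
pairing, loops and finite transducers (`PT.comp`, `PT.pair`, `PT.loop`, `PT.transduce`). On top of
these, `PolyTM.CP x y` says the same for structured data, and is closed under recursion along lists
(`CP.iterate`). There the bounds on the intermediate results are needed only for the inputs that are
indexed, which is how the restriction to queries of the class enters. The given machine that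
computes cores is plugged in by `PT.of_computable` and `PT.comp`.
-/

set_option linter.unusedSectionVars false

/-! ### Runs of stack machines and program fragments -/

namespace PolyTM

open Turing Function

variable {K : Type} [DecidableEq K] {Γ : K → Type} {Λ Λ' σ : Type}

/-- `StepsTo m t c d`: the program `m` leads from `c` to `d` in exactly `t` steps. -/
inductive StepsTo (m : Λ → TM2.Stmt Γ Λ σ) : ℕ → TM2.Cfg Γ Λ σ → TM2.Cfg Γ Λ σ → Prop
  | refl (c : TM2.Cfg Γ Λ σ) : StepsTo m 0 c c
  | head {l v S t d} : StepsTo m t (TM2.stepAux (m l) v S) d → StepsTo m (t + 1) ⟨some l, v, S⟩ d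

theorem StepsTo.trans {m : Λ → TM2.Stmt Γ Λ σ} {t₁ t₂ : ℕ} {c d e : TM2.Cfg Γ Λ σ}
    (h₁ : StepsTo m t₁ c d) (h₂ : StepsTo m t₂ d e) : StepsTo m (t₁ + t₂) c e := by
  induction h₁ with
  | refl c => simpa using h₂
  | head _ ih =>
    rw [Nat.add_right_comm]
    exact .head (ih h₂)

theorem iterate_flip_bind_none {α : Type} (f : α → Option α) (n : ℕ) :
    (flip bind f)^[n] none = none := by
  induction n with
  | zero => rfl
  | succ n ih => rw [iterate_succ_apply]; exact ih

theorem stepsTo_iff (m : Λ → TM2.Stmt Γ Λ σ) (t : ℕ) (c d : TM2.Cfg Γ Λ σ) :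
    StepsTo m t c d ↔ (flip bind (TM2.step m))^[t] (some c) = some d := by
  constructor
  · intro h
    induction h with
    | refl c => rfl
    | head _ ih => rw [iterate_succ_apply]; exact ih
  · intro h
    induction t generalizing c with
    | zero => cases h; exact .refl _
    | succ t ih =>
      rw [iterate_succ_apply] at h
      rcases c with ⟨_ | l, v, S⟩
      · change (flip bind (TM2.step m))^[t] none = some d at h
        rw [iterate_flip_bind_none] at h
        cases h
      · exact .head (ih _ h)

/-- All stacks are empty. -/
def emp (Γ : K → Type) : ∀ k, List (Γ k) := fun _ => []

@[simp] theorem emp_apply (k : K) : emp Γ k = [] := rfl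

@[simp] theorem update_emp_nil (k : K) : update (emp Γ) k [] = emp Γ := update_eq_self k (emp Γ)

/-- Rename the labels of a statement along `j` and replace `halt` by `h`. -/
def mapStmt (j : Λ → Λ') (h : TM2.Stmt Γ Λ' σ) : TM2.Stmt Γ Λ σ → TM2.Stmt Γ Λ' σ
  | .push k f q => .push k f (mapStmt j h q)
  | .peek k f q => .peek k f (mapStmt j h q)
  | .pop k f q => .pop k f (mapStmt j h q)
  | .load a q => .load a (mapStmt j h q)
  | .branch f q₁ q₂ => .branch f (mapStmt j h q₁) (mapStmt j h q₂)
  | .goto f => .goto fun v => j (f v)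
  | .halt => h

theorem stepAux_mapStmt (j : Λ → Λ') (h : TM2.Stmt Γ Λ' σ) (q : TM2.Stmt Γ Λ σ) (v : σ)
    (S : ∀ k, List (Γ k)) :
    TM2.stepAux (mapStmt j h q) v S =
      match TM2.stepAux q v S with
      | ⟨some l, v', S'⟩ => ⟨some (j l), v', S'⟩
      | ⟨none, v', S'⟩ => TM2.stepAux h v' S' := by
  induction q generalizing v S with
  | branch f q₁ q₂ ih₁ ih₂ =>
    simp only [mapStmt, TM2.stepAux]
    cases f v <;> simp [ih₁, ih₂]
  | _ => simp_all [mapStmt]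

theorem StepsTo.mapStmt {m : Λ → TM2.Stmt Γ Λ σ} {m' : Λ' → TM2.Stmt Γ Λ' σ} {j : Λ → Λ'}
    {h : TM2.Stmt Γ Λ' σ} (hm : ∀ l, m' (j l) = PolyTM.mapStmt j h (m l)) {t : ℕ} {l : Λ} {v v' : σ}
    {S S' : ∀ k, List (Γ k)} (hs : StepsTo m t ⟨some l, v, S⟩ ⟨none, v', S'⟩) :
    StepsTo m' t ⟨some (j l), v, S⟩ (TM2.stepAux h v' S') := by
  induction t generalizing l v S with
  | zero => cases hs
  | succ t ih =>
    cases hs with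
    | head hs =>
      refine .head ?_
      rw [hm, stepAux_mapStmt]
      rcases hc : TM2.stepAux (m l) v S with ⟨_ | l', v₁, S₁⟩
      · rw [hc] at hs
        cases hs
        exact .refl _
      · rw [hc] at hs
        exact ih hs

/-- A program fragment: a program with an entry point, which is left by `halt`. -/
structure Frag (Γ : K → Type) (σ : Type) where
  Λ : Type
  [fin : Fintype Λ]
  entry : Λ
  m : Λ → TM2.Stmt Γ Λ σ

attribute [instance] Frag.fin

namespace Frag

/-- From state `v` and stacks `S`, the fragment halts within `t` steps in state `v'` with
stacks `S'`. -/
def Exec (F : Frag Γ σ) (t : ℕ) (v : σ) (S : ∀ k, List (Γ k)) (v' : σ) (S' : ∀ k, List (Γ k)) :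
    Prop :=
  ∃ t' ≤ t, StepsTo F.m t' ⟨some F.entry, v, S⟩ ⟨none, v', S'⟩

/-- Sequential composition. -/
def seq (F G : Frag Γ σ) : Frag Γ σ where
  Λ := F.Λ ⊕ G.Λ
  entry := .inl F.entry
  m
    | .inl l => mapStmt .inl (.goto fun _ => .inr G.entry) (F.m l)
    | .inr l => mapStmt .inr .halt (G.m l)

theorem Exec.seq {F G : Frag Γ σ} {t₁ t₂ : ℕ} {v v' v'' : σ} {S S' S'' : ∀ k, List (Γ k)}
    (h₁ : F.Exec t₁ v S v' S') (h₂ : G.Exec t₂ v' S' v'' S'') :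
    (F.seq G).Exec (t₁ + t₂) v S v'' S'' := by
  obtain ⟨t₁', ht₁, h₁⟩ := h₁
  obtain ⟨t₂', ht₂, h₂⟩ := h₂
  exact ⟨t₁' + t₂', add_le_add ht₁ ht₂,
    (h₁.mapStmt (m' := (F.seq G).m) (j := .inl) (fun _ => rfl)).trans
      (h₂.mapStmt (m' := (F.seq G).m) (j := .inr) (fun _ => rfl))⟩

theorem Exec.mono {F : Frag Γ σ} {t t' : ℕ} {v v' : σ} {S S' : ∀ k, List (Γ k)}
    (h : F.Exec t v S v' S') (ht : t ≤ t') : F.Exec t' v S v' S' :=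
  let ⟨t₁, h₁, h₂⟩ := h
  ⟨t₁, h₁.trans ht, h₂⟩

/-- Move the contents of stack `a` to stack `b` (which reverses the order), applying `e ∘ some ∘ f`
to every symbol. The first component of the state is the register that holds the symbol; it is
empty at the end. -/
def drain {G τ : Type} (a : K) (f : Γ a → G) (b : K) (e : Option G → Γ b) :
    Frag Γ (Option G × τ) where
  Λ := Unit
  entry := ()
  m _ := .pop a (fun s o => (o.map f, s.2)) (.branch (fun s => s.1.isSome)
    (.push b (fun s => e s.1) (.goto fun _ => ())) .halt)

theorem exec_drain {G τ : Type} {a : K} (f : Γ a → G) {b : K} (e : Option G → Γ b) (hab : a ≠ b)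
    (v : Option G × τ) (S : ∀ k, List (Γ k)) :
    (drain a f b e).Exec ((S a).length + 1) v S (none, v.2)
      (update (update S a []) b (((S a).map fun x => e (some (f x))).reverse ++ S b)) := by
  refine ⟨_, le_rfl, ?_⟩
  generalize hl : S a = l
  induction l generalizing v S with
  | nil =>
    refine .head ?_
    have : update S a [] = S := by rw [← hl, update_eq_self]
    have h0 := StepsTo.refl (m := (drain (τ := τ) a f b e).m) ⟨none, (none, v.2), S⟩
    simpa [drain, hl, this] using h0
  | cons x l ih =>
    refine .head ?_
    have h := ih (v := (some (f x), v.2))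
      (S := update (update S a l) b (e (some (f x)) :: S b)) (by simp [hab])
    have h2 : update (update (update (update S a l) b (e (some (f x)) :: S b)) a []) b =
        update (update S a []) b := by
      funext z
      rw [update_comm hab.symm, update_idem, update_idem]
    simp only [h2] at h
    simpa [drain, hl, update_of_ne hab.symm] using h

/-- Move the contents of stack `a` to both of the stacks `b` and `c`. -/
def drain₂ {G τ : Type} (a : K) (f : Γ a → G) (b : K) (e : Option G → Γ b) (c : K)
    (e' : Option G → Γ c) : Frag Γ (Option G × τ) where
  Λ := Unit
  entry := ()
  m _ := .pop a (fun s o => (o.map f, s.2)) (.branch (fun s => s.1.isSome)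
    (.push b (fun s => e s.1) (.push c (fun s => e' s.1) (.goto fun _ => ()))) .halt)

theorem exec_drain₂ {G τ : Type} {a : K} (f : Γ a → G) {b : K} (e : Option G → Γ b) {c : K}
    (e' : Option G → Γ c) (hab : a ≠ b) (hac : a ≠ c) (hbc : b ≠ c)
    (v : Option G × τ) (S : ∀ k, List (Γ k)) :
    (drain₂ a f b e c e').Exec ((S a).length + 1) v S (none, v.2)
      (update (update (update S a []) b (((S a).map fun x => e (some (f x))).reverse ++ S b))
        c (((S a).map fun x => e' (some (f x))).reverse ++ S c)) := by
  refine ⟨_, le_rfl, ?_⟩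
  generalize hl : S a = l
  induction l generalizing v S with
  | nil =>
    refine .head ?_
    have : update S a [] = S := by rw [← hl, update_eq_self]
    have h0 := StepsTo.refl (m := (drain₂ (τ := τ) a f b e c e').m) ⟨none, (none, v.2), S⟩
    simpa [drain₂, hl, this] using h0
  | cons x l ih =>
    refine .head ?_
    have h := ih (v := (some (f x), v.2))
      (S := update (update (update S a l) b (e (some (f x)) :: S b)) c (e' (some (f x)) :: S c))
      (by simp [hab, hac])
    have h2 : ∀ y z, update (update (update (update (update (update S a l) b
        (e (some (f x)) :: S b)) c (e' (some (f x)) :: S c)) a []) b y) c z =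
        update (update (update S a []) b y) c z := by
      intro y z
      rw [update_comm hac.symm, update_comm hab.symm, update_idem, update_comm hbc.symm,
        update_idem, update_idem]
    simp only [h2] at h
    simpa [drain₂, hl, update_of_ne hab.symm, update_of_ne hac.symm, update_of_ne hbc,
      update_of_ne hbc.symm] using h

/-- While the top symbol of stack `k` satisfies `p`, execute `F`. The outcome of the test is recorded
in the first component of the state; `c₁` and `c₀` are its values for success and failure, which
`b` tells apart. -/
def loop {R τ : Type} (k : K) (p : Option (Γ k) → Bool) (c₁ c₀ : R) (b : R → Bool)
    (F : Frag Γ (R × τ)) : Frag Γ (R × τ) where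
  Λ := Option F.Λ
  entry := none
  m
    | none => .peek k (fun s o => (bif p o then c₁ else c₀, s.2))
        (.branch (fun s => b s.1) (.load (fun s => (c₀, s.2)) (.goto fun _ => some F.entry)) .halt)
    | some l => mapStmt some (.goto fun _ => none) (F.m l)

theorem exec_loop {R τ : Type} {k : K} {p : Option (Γ k) → Bool} {c₁ c₀ : R} {b : R → Bool}
    (hc₁ : b c₁ = true) (hc₀ : b c₀ = false) {F : Frag Γ (R × τ)} {w : τ} {T N : ℕ}
    {S : ℕ → ∀ k, List (Γ k)}
    (hF : ∀ n < N, F.Exec T (c₀, w) (S n) (c₀, w) (S (n + 1)))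
    (hp : ∀ n < N, p (S n k).head? = true) (hN : p (S N k).head? = false) :
    (loop k p c₁ c₀ b F).Exec (N * (T + 1) + 1) (c₀, w) (S 0) (c₀, w) (S N) := by
  induction N generalizing S with
  | zero =>
    refine ⟨1, by simp, .head ?_⟩
    simpa [loop, hN, hc₀] using StepsTo.refl _
  | succ N ih =>
    obtain ⟨t, ht, h⟩ := ih (S := fun n => S (n + 1)) (fun n hn => hF _ (by omega))
      (fun n hn => hp _ (by omega)) hN
    obtain ⟨t', ht', h'⟩ := hF 0 (by omega)
    refine ⟨t' + t + 1, by rw [add_mul]; omega, .head ?_⟩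
    have := (h'.mapStmt (m' := (loop k p c₁ c₀ b F).m) (j := some) (fun _ => rfl)).trans h
    simpa [loop, hp 0 (by omega), hc₁] using this

end Frag

/-! ### Machines as subroutines -/

section Sum

variable {H : Type} [DecidableEq H] {Δ : H → Type} {τ : Type}

/-- The stack alphabets of two machines side by side. (`Sum.casesOn` in place of `Sum.elim` makes
the value at a given stack reduce without unfolding definitions.) -/
abbrev SumFam (Δ : H → Type) (Γ : K → Type) (k : H ⊕ K) : Type :=
  Sum.casesOn (motive := fun _ => Type) k Δ Γ

/-- The contents of the stacks of two machines side by side. -/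
def st (h : ∀ a, List (Δ a)) (s : ∀ k, List (Γ k)) : ∀ k, List (SumFam Δ Γ k)
  | .inl a => h a
  | .inr k => s k

@[simp] theorem st_inl (h : ∀ a, List (Δ a)) (s : ∀ k, List (Γ k)) (a : H) :
    st h s (.inl a) = h a := rfl

@[simp] theorem st_inr (h : ∀ a, List (Δ a)) (s : ∀ k, List (Γ k)) (k : K) :
    st h s (.inr k) = s k := rfl

@[simp] theorem update_st_inl (h : ∀ a, List (Δ a)) (s : ∀ k, List (Γ k)) (a : H)
    (l : List (Δ a)) : update (st h s) (.inl a) l = st (update h a l) s := by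
  funext k
  rcases k with b | k
  · by_cases hb : b = a
    · subst hb; simp
    · simp [hb]
  · simp

@[simp] theorem update_st_inr (h : ∀ a, List (Δ a)) (s : ∀ k, List (Γ k)) (k : K)
    (l : List (Γ k)) : update (st h s) (.inr k) l = st h (update s k l) := by
  funext z
  rcases z with b | z
  · simp
  · by_cases hb : z = k
    · subst hb; simp
    · simp [hb]

@[simp] theorem st_emp_emp : st (emp Δ) (emp Γ) = emp (SumFam Δ Γ) := by
  funext k
  rcases k with _ | _ <;> rfl

/-- Execute a statement on the right half of the stacks. -/
def stmtR (Δ : H → Type) (τ : Type) : TM2.Stmt Γ Λ σ → TM2.Stmt (SumFam Δ Γ) Λ (τ × σ)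
  | .push k f q => .push (.inr k) (fun s => f s.2) (stmtR Δ τ q)
  | .peek k f q => .peek (.inr k) (fun s o => (s.1, f s.2 o)) (stmtR Δ τ q)
  | .pop k f q => .pop (.inr k) (fun s o => (s.1, f s.2 o)) (stmtR Δ τ q)
  | .load a q => .load (fun s => (s.1, a s.2)) (stmtR Δ τ q)
  | .branch f q₁ q₂ => .branch (fun s => f s.2) (stmtR Δ τ q₁) (stmtR Δ τ q₂)
  | .goto f => .goto fun s => f s.2
  | .halt => .halt

/-- Execute a statement on the left half of the stacks. -/
def stmtL (Δ : H → Type) (τ : Type) : TM2.Stmt Γ Λ σ → TM2.Stmt (SumFam Γ Δ) Λ (σ × τ)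
  | .push k f q => .push (.inl k) (fun s => f s.1) (stmtL Δ τ q)
  | .peek k f q => .peek (.inl k) (fun s o => (f s.1 o, s.2)) (stmtL Δ τ q)
  | .pop k f q => .pop (.inl k) (fun s o => (f s.1 o, s.2)) (stmtL Δ τ q)
  | .load a q => .load (fun s => (a s.1, s.2)) (stmtL Δ τ q)
  | .branch f q₁ q₂ => .branch (fun s => f s.1) (stmtL Δ τ q₁) (stmtL Δ τ q₂)
  | .goto f => .goto fun s => f s.1
  | .halt => .halt

theorem stepAux_stmtR (q : TM2.Stmt Γ Λ σ) (w : τ) (v : σ) (h : ∀ a, List (Δ a))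
    (S : ∀ k, List (Γ k)) :
    TM2.stepAux (stmtR Δ τ q) (w, v) (st h S) =
      ⟨(TM2.stepAux q v S).l, (w, (TM2.stepAux q v S).var), st h (TM2.stepAux q v S).stk⟩ := by
  induction q generalizing v S with
  | branch f q₁ q₂ ih₁ ih₂ =>
    simp only [stmtR, TM2.stepAux]
    cases f v <;> simp [ih₁, ih₂]
  | push k f q ih =>
    simp only [stmtR, TM2.stepAux]
    erw [update_st_inr, ih]; rfl
  | pop k f q ih =>
    simp only [stmtR, TM2.stepAux]
    erw [update_st_inr, ih]; rfl
  | peek k f q ih =>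
    simp only [stmtR, TM2.stepAux]
    erw [ih]; rfl
  | _ => simp_all [stmtR]

theorem stepAux_stmtL (q : TM2.Stmt Γ Λ σ) (w : τ) (v : σ) (h : ∀ a, List (Δ a))
    (S : ∀ k, List (Γ k)) :
    TM2.stepAux (stmtL Δ τ q) (v, w) (st S h) =
      ⟨(TM2.stepAux q v S).l, ((TM2.stepAux q v S).var, w), st (TM2.stepAux q v S).stk h⟩ := by
  induction q generalizing v S with
  | branch f q₁ q₂ ih₁ ih₂ =>
    simp only [stmtL, TM2.stepAux]
    cases f v <;> simp [ih₁, ih₂]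
  | push k f q ih =>
    simp only [stmtL, TM2.stepAux]
    erw [update_st_inl, ih]; rfl
  | pop k f q ih =>
    simp only [stmtL, TM2.stepAux]
    erw [update_st_inl, ih]; rfl
  | peek k f q ih =>
    simp only [stmtL, TM2.stepAux]
    erw [ih]; rfl
  | _ => simp_all [stmtL]

namespace Frag

/-- A fragment as part of a machine with further stacks and a further state component. -/
def right (Δ : H → Type) (τ : Type) (F : Frag Γ σ) : Frag (SumFam Δ Γ) (τ × σ) where
  Λ := F.Λ
  entry := F.entry
  m l := stmtR Δ τ (F.m l)

/-- A fragment as part of a machine with further stacks and a further state component. -/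
def left (Δ : H → Type) (τ : Type) (F : Frag Γ σ) : Frag (SumFam Γ Δ) (σ × τ) where
  Λ := F.Λ
  entry := F.entry
  m l := stmtL Δ τ (F.m l)

theorem Exec.right {F : Frag Γ σ} {t : ℕ} {v v' : σ} {S S' : ∀ k, List (Γ k)}
    (h : F.Exec t v S v' S') (w : τ) (s : ∀ a, List (Δ a)) :
    (F.right Δ τ).Exec t (w, v) (st s S) (w, v') (st s S') := by
  obtain ⟨t', ht, h⟩ := h
  refine ⟨t', ht, ?_⟩
  have key : ∀ t (c d : TM2.Cfg Γ F.Λ σ), StepsTo F.m t c d →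
      StepsTo (F.right Δ τ).m t ⟨c.l, (w, c.var), st s c.stk⟩ ⟨d.l, (w, d.var), st s d.stk⟩ := by
    intro t c d h
    induction h with
    | refl c => exact .refl _
    | head _ ih =>
      refine .head ?_
      simpa only [Frag.right, stepAux_stmtR] using ih
  exact key _ _ _ h

theorem Exec.left {F : Frag Γ σ} {t : ℕ} {v v' : σ} {S S' : ∀ k, List (Γ k)}
    (h : F.Exec t v S v' S') (w : τ) (s : ∀ a, List (Δ a)) :
    (F.left Δ τ).Exec t (v, w) (st S s) (v', w) (st S' s) := by
  obtain ⟨t', ht, h⟩ := h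
  refine ⟨t', ht, ?_⟩
  have key : ∀ t (c d : TM2.Cfg Γ F.Λ σ), StepsTo F.m t c d →
      StepsTo (F.left Δ τ).m t ⟨c.l, (c.var, w), st c.stk s⟩ ⟨d.l, (d.var, w), st d.stk s⟩ := by
    intro t c d h
    induction h with
    | refl c => exact .refl _
    | head _ ih =>
      refine .head ?_
      simpa only [Frag.left, stepAux_stmtL] using ih
  exact key _ _ _ h

end Frag

end Sum

/-! ### The length of the output -/

/-- The number of `push` commands of a statement. -/
def pushes : TM2.Stmt Γ Λ σ → ℕ
  | .push _ _ q => pushes q + 1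
  | .peek _ _ q => pushes q
  | .pop _ _ q => pushes q
  | .load _ q => pushes q
  | .branch _ q₁ q₂ => pushes q₁ + pushes q₂
  | .goto _ => 0
  | .halt => 0

theorem length_stepAux_le (q : TM2.Stmt Γ Λ σ) (v : σ) (S : ∀ k, List (Γ k)) (k : K) :
    ((TM2.stepAux q v S).stk k).length ≤ (S k).length + pushes q := by
  induction q generalizing v S with
  | push k' f q ih =>
    refine (ih v _).trans ?_
    by_cases h : k = k'
    · subst h; simp [pushes]; omega
    · simp [pushes, h]
  | pop k' f q ih =>
    refine (ih _ _).trans ?_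
    by_cases h : k = k'
    · subst h; simp [pushes]
    · simp [pushes, h]
  | peek k' f q ih => exact ih _ _
  | load a q ih => exact ih _ _
  | branch f q₁ q₂ ih₁ ih₂ =>
    simp only [TM2.stepAux, pushes]
    cases f v
    · exact (ih₂ v S).trans (by omega)
    · exact (ih₁ v S).trans (by omega)
  | goto f => simp [pushes]
  | halt => simp [pushes]

theorem StepsTo.length_le {m : Λ → TM2.Stmt Γ Λ σ} {t : ℕ} {c d : TM2.Cfg Γ Λ σ}
    (h : StepsTo m t c d) {C : ℕ} (hC : ∀ l, pushes (m l) ≤ C) (k : K) :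
    (d.stk k).length ≤ (c.stk k).length + t * C := by
  induction h with
  | refl c => simp
  | head _ ih =>
    rename_i l v S t d _
    have := length_stepAux_le (m l) v S k
    have := hC l
    rw [add_mul]
    simp only at *
    omega

end PolyTM

/-! ### Polynomial bounds -/

namespace PolyTM

open Turing Function

/-- `t` is bounded by a polynomial in `s`. -/
def PolyBdd {ι : Type} (s t : ι → ℕ) : Prop := ∃ p : Polynomial ℕ, ∀ i, t i ≤ p.eval (s i)

theorem eval_mono (p : Polynomial ℕ) : Monotone fun n => p.eval n := by
  intro a b hab
  simp only [Polynomial.eval_eq_sum_range]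
  gcongr

namespace PolyBdd

variable {ι : Type} {s t r : ι → ℕ}

theorem refl (s : ι → ℕ) : PolyBdd s s := ⟨Polynomial.X, by simp⟩

theorem const (s : ι → ℕ) (c : ℕ) : PolyBdd s fun _ => c := ⟨Polynomial.C c, by simp⟩

theorem add (ht : PolyBdd s t) (hr : PolyBdd s r) : PolyBdd s fun i => t i + r i :=
  let ⟨p, hp⟩ := ht
  let ⟨q, hq⟩ := hr
  ⟨p + q, fun i => by simpa using add_le_add (hp i) (hq i)⟩

theorem mul (ht : PolyBdd s t) (hr : PolyBdd s r) : PolyBdd s fun i => t i * r i :=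
  let ⟨p, hp⟩ := ht
  let ⟨q, hq⟩ := hr
  ⟨p * q, fun i => by simpa using mul_le_mul' (hp i) (hq i)⟩

theorem pow (ht : PolyBdd s t) (k : ℕ) : PolyBdd s fun i => t i ^ k :=
  let ⟨p, hp⟩ := ht
  ⟨p ^ k, fun i => by simpa using Nat.pow_le_pow_left (hp i) k⟩

theorem trans (ht : PolyBdd s t) (hr : PolyBdd t r) : PolyBdd s r :=
  let ⟨p, hp⟩ := ht
  let ⟨q, hq⟩ := hr
  ⟨q.comp p, fun i => by
    rw [Polynomial.eval_comp]
    exact (hq i).trans (eval_mono q (hp i))⟩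

theorem eval (ht : PolyBdd s t) (p : Polynomial ℕ) : PolyBdd s fun i => p.eval (t i) :=
  ht.trans ⟨p, fun _ => le_rfl⟩

theorem mono (ht : PolyBdd s t) (h : ∀ i, r i ≤ t i) : PolyBdd s r :=
  let ⟨p, hp⟩ := ht
  ⟨p, fun i => (h i).trans (hp i)⟩

end PolyBdd

/-! ### Polynomial time transformations of strings -/

attribute [instance] FinTM2.kFin FinTM2.ΛFin FinTM2.σFin FinTM2.Γk₀Fin

/-- The program of a machine as a fragment. -/
def machineFrag (M : FinTM2) : Frag M.Γ M.σ where
  Λ := M.Λ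
  entry := M.main
  m := M.m

/-- Some machine transforms the string `u i` into the string `v i`, for every index `i`, in time
polynomial in the length of `u i`. The strings are indexed in order that the input need not range
over all strings: an index may stand for a query of the class, or for an input together with the
number of a round of a loop. -/
def PT {ι A B : Type} (u : ι → List A) (v : ι → List B) : Prop :=
  ∃ (M : TM2ComputableAux A B) (p : Polynomial ℕ), ∀ i,
    (machineFrag M.tm).Exec (p.eval (u i).length)
      M.tm.initialState (update (emp _) M.tm.k₀ ((u i).map M.inputAlphabet.symm))
      M.tm.initialState (update (emp _) M.tm.k₁ ((v i).map M.outputAlphabet.symm))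

theorem initList_eq (M : FinTM2) (l : List (M.Γ M.k₀)) :
    initList M l = ⟨some M.main, M.initialState, update (emp _) M.k₀ l⟩ := by
  unfold initList
  congr 1
  funext k
  by_cases h : k = M.k₀
  · subst h; simp
  · simp [h]

theorem haltList_eq (M : FinTM2) (l : List (M.Γ M.k₁)) :
    haltList M l = ⟨none, M.initialState, update (emp _) M.k₁ l⟩ := by
  unfold haltList
  congr 1
  funext k
  by_cases h : k = M.k₁
  · subst h; simp
  · simp [h]

namespace PT

variable {ι κ A B C : Type} {u : ι → List A} {v : ι → List B} {w : ι → List C}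

/-- Machines in the sense of Mathlib, such as the one that computes cores, can be used as
subroutines. -/
theorem of_computable {α β : Type} {ea : α → List A} {eb : β → List B} {f : α → β}
    (h : TM2ComputableInPolyTime ea eb f) : PT ea fun a => eb (f a) := by
  refine ⟨h.toTM2ComputableAux, h.time, fun a => ?_⟩
  obtain ⟨⟨t, ht⟩, htm⟩ := h.outputsFun a
  refine ⟨t, htm, (stepsTo_iff _ _ _ _).2 ?_⟩
  have h1 := initList_eq h.tm ((ea a).map h.inputAlphabet.invFun)
  have h2 := haltList_eq h.tm ((eb (f a)).map h.outputAlphabet.invFun)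
  rw [h1] at ht
  simp only [Option.map_some, h2] at ht
  exact ht

theorem computable {α β : Type} {ea : α → List A} {eb : β → List B} {f : α → β}
    (h : PT ea fun a => eb (f a)) : Nonempty (TM2ComputableInPolyTime ea eb f) := by
  obtain ⟨M, p, h⟩ := h
  refine ⟨⟨M, p, fun a => Classical.choice ?_⟩⟩
  obtain ⟨t, htm, ht⟩ := h a
  refine ⟨⟨⟨t, ?_⟩, htm⟩⟩
  have ht := (stepsTo_iff _ _ _ _).1 ht
  have h1 := initList_eq M.tm ((ea a).map M.inputAlphabet.invFun)
  have h2 := haltList_eq M.tm ((eb (f a)).map M.outputAlphabet.invFun)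
  rw [h1]
  simp only [Option.map_some, h2]
  exact ht

theorem reindex (h : PT u v) (f : κ → ι) : PT (fun k => u (f k)) fun k => v (f k) :=
  let ⟨M, p, h⟩ := h
  ⟨M, p, fun i => h (f i)⟩

theorem of_frag {K σ : Type} [DecidableEq K] [Fintype K] {Γ : K → Type} [Fintype σ] [Fintype A]
    (F : Frag Γ σ) (k₀ k₁ : K) (a : Γ k₀ ≃ A) (b : Γ k₁ ≃ B) (init : σ) {t : ι → ℕ}
    (ht : PolyBdd (fun i => (u i).length) t)
    (h : ∀ i, F.Exec (t i) init (update (emp Γ) k₀ ((u i).map a.symm))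
      init (update (emp Γ) k₁ ((v i).map b.symm))) : PT u v := by
  obtain ⟨p, hp⟩ := ht
  let _ : Fintype (Γ k₀) := Fintype.ofEquiv A a.symm
  exact ⟨⟨⟨k₀, k₁, Γ, F.Λ, F.entry, σ, init, F.m⟩, a, b⟩, p, fun i => (h i).mono (hp i)⟩

/-- A statement pushes a bounded number of symbols, so the output is not much longer than the
running time. -/
theorem length_le (h : PT u v) : PolyBdd (fun i => (u i).length) fun i => (v i).length := by
  obtain ⟨M, p, h⟩ := h
  obtain ⟨D, hD⟩ : ∃ D, ∀ l, pushes (M.tm.m l) ≤ D := by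
    obtain ⟨D, hD⟩ := (Set.finite_range fun l => pushes (M.tm.m l)).bddAbove
    exact ⟨D, fun l => hD ⟨l, rfl⟩⟩
  refine (((PolyBdd.refl _).add (((PolyBdd.refl _).eval p).mul (.const _ D)))).mono fun i => ?_
  obtain ⟨t, ht, h⟩ := h i
  have := h.length_le hD M.tm.k₁
  simp only [update_self, List.length_map] at this
  refine this.trans (add_le_add ?_ (Nat.mul_le_mul_right _ ht))
  by_cases hk : M.tm.k₁ = M.tm.k₀
  · rw [hk]; simp
  · simp [hk]

section

variable {H K : Type} [DecidableEq H] [DecidableEq K] {Δ : H → Type} {Γ : K → Type}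

@[simp] theorem update_emp_inl (a : H) (l : List (Δ a)) :
    update (emp (SumFam Δ Γ)) (.inl a) l = st (update (emp Δ) a l) (emp Γ) := by
  rw [← st_emp_emp, update_st_inl]

@[simp] theorem update_emp_inr (a : K) (l : List (Γ a)) :
    update (emp (SumFam Δ Γ)) (.inr a) l = st (emp Δ) (update (emp Γ) a l) := by
  rw [← st_emp_emp, update_st_inr]

end

/-- The first machine runs, its output is moved to the input stack of the second one by way of an
auxiliary stack (every move reverses the order), and the second machine runs. -/
theorem comp [Fintype A] [Fintype B] [Inhabited B] (h₁ : PT u v) (h₂ : PT v w) : PT u w := by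
  have hlen := h₁.length_le
  obtain ⟨M, p, hM⟩ := h₁
  obtain ⟨N, q, hN⟩ := h₂
  let Γ := SumFam (fun _ : Unit => B) (SumFam M.tm.Γ N.tm.Γ)
  let d₁ : Frag Γ (Option B × (M.tm.σ × N.tm.σ)) :=
    .drain (.inr (.inl M.tm.k₁)) M.outputAlphabet (.inl ()) (fun o => o.getD default)
  let d₂ : Frag Γ (Option B × (M.tm.σ × N.tm.σ)) :=
    .drain (.inl ()) id (.inr (.inr N.tm.k₀)) (fun o => N.inputAlphabet.symm (o.getD default))
  refine of_frag
    (((((machineFrag M.tm).left N.tm.Γ N.tm.σ).right (fun _ : Unit => B) (Option B)).seq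
      (d₁.seq d₂)).seq (((machineFrag N.tm).right M.tm.Γ M.tm.σ).right _ _))
    (.inr (.inl M.tm.k₀)) (.inr (.inr N.tm.k₁)) M.inputAlphabet N.outputAlphabet
    (none, (M.tm.initialState, N.tm.initialState))
    (t := fun i => p.eval (u i).length + ((v i).length + 1 + ((v i).length + 1)) +
      q.eval (v i).length) ?_ fun i => ?_
  · exact (((PolyBdd.refl _).eval p).add ((hlen.add (.const _ 1)).add (hlen.add (.const _ 1)))).add
      (hlen.eval q)
  · have e₁ := (((hM i).left N.tm.initialState (emp N.tm.Γ)).right (none : Option B)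
      (emp fun _ : Unit => B))
    have e₂ := Frag.exec_drain (τ := M.tm.σ × N.tm.σ) (Γ := Γ) (a := .inr (.inl M.tm.k₁))
      M.outputAlphabet (b := .inl ()) (fun o => o.getD default) (by simp)
      (none, (M.tm.initialState, N.tm.initialState))
      (st (emp _) (st (update (emp _) M.tm.k₁ ((v i).map M.outputAlphabet.symm)) (emp _)))
    have e₃ := Frag.exec_drain (τ := M.tm.σ × N.tm.σ) (Γ := Γ) (a := .inl ())
      id (b := .inr (.inr N.tm.k₀)) (fun o => N.inputAlphabet.symm (o.getD default)) (by simp)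
      (none, (M.tm.initialState, N.tm.initialState))
      (st (update (emp _) () (v i).reverse) (emp _))
    have e₄ := (((hN i).right M.tm.initialState (emp M.tm.Γ)).right (none : Option B)
      (emp fun _ : Unit => B))
    simp [Γ] at e₂ e₃
    have := (e₁.seq (e₂.seq e₃)).seq e₄
    simpa using this

end PT

end PolyTM

namespace PolyTM

open Turing Function

/-- Two strings as one, over the disjoint union of the alphabets. -/
def pairStr {A B : Type} (u : List A) (v : List B) : List (A ⊕ B) := u.map .inl ++ v.map .inr

namespace PT

variable {ι κ A B C : Type} {u : ι → List A} {v : ι → List B} {w : ι → List C}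

/-- The input is copied to the input stacks of both machines; after both have run, their outputs
are joined. -/
theorem pair [Fintype A] [Fintype B] [Fintype C] [Inhabited A] [Inhabited B]
    (h₁ : PT u v) (h₂ : PT u w) : PT u fun i => pairStr (v i) (w i) := by
  have hv := h₁.length_le
  have hw := h₂.length_le
  obtain ⟨M, p, hM⟩ := h₁
  obtain ⟨N, q, hN⟩ := h₂
  have : Inhabited (B ⊕ C) := ⟨.inl default⟩
  let Δ : Bool ⊕ Bool → Type := SumFam (fun _ : Bool => A) (fun _ : Bool => B ⊕ C)
  let Γ := SumFam Δ (SumFam M.tm.Γ N.tm.Γ)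
  let R := A ⊕ (B ⊕ C)
  let e₁ : Option R → A := fun o => (o.bind Sum.getLeft?).getD default
  let e₂ : Option R → B ⊕ C := fun o => (o.bind Sum.getRight?).getD default
  let τ := M.tm.σ × N.tm.σ
  let init : Option R × τ := (none, (M.tm.initialState, N.tm.initialState))
  -- the stacks `inp` and `aux` hold symbols of the input, `mid` and `out` symbols of the output
  let inp : (Bool ⊕ Bool) ⊕ (M.tm.K ⊕ N.tm.K) := .inl (.inl false)
  let aux : (Bool ⊕ Bool) ⊕ (M.tm.K ⊕ N.tm.K) := .inl (.inl true)
  let mid : (Bool ⊕ Bool) ⊕ (M.tm.K ⊕ N.tm.K) := .inl (.inr false)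
  let out : (Bool ⊕ Bool) ⊕ (M.tm.K ⊕ N.tm.K) := .inl (.inr true)
  let d₁ : Frag Γ (Option R × τ) := .drain inp .inl aux e₁
  let d₂ : Frag Γ (Option R × τ) := .drain₂ aux .inl
    (.inr (.inl M.tm.k₀)) (fun o => M.inputAlphabet.symm (e₁ o))
    (.inr (.inr N.tm.k₀)) (fun o => N.inputAlphabet.symm (e₁ o))
  let d₃ : Frag Γ (Option R × τ) := .drain (.inr (.inl M.tm.k₁))
    (fun x => .inr (.inl (M.outputAlphabet x))) mid e₂
  let d₄ : Frag Γ (Option R × τ) := .drain (.inr (.inr N.tm.k₁))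
    (fun x => .inr (.inr (N.outputAlphabet x))) mid e₂
  let d₅ : Frag Γ (Option R × τ) := .drain mid .inr out e₂
  let FM : Frag Γ (Option R × τ) := ((machineFrag M.tm).left N.tm.Γ N.tm.σ).right Δ (Option R)
  let FN : Frag Γ (Option R × τ) := ((machineFrag N.tm).right M.tm.Γ M.tm.σ).right Δ (Option R)
  refine of_frag (d₁.seq (d₂.seq (FM.seq (FN.seq (d₃.seq (d₄.seq d₅))))))
    inp out (.refl _) (.refl _) init
    (t := fun i => ((u i).length + 1) + (((u i).length + 1) + (p.eval (u i).length +
      (q.eval (u i).length + (((v i).length + 1) + (((w i).length + 1) +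
      ((v i).length + (w i).length + 1))))))) ?_ fun i => ?_
  · have hu := PolyBdd.refl fun i => (u i).length
    have h1 := fun {t : ι → ℕ} => PolyBdd.const t 1
    exact (hu.add h1).add ((hu.add h1).add ((hu.eval p).add ((hu.eval q).add
      ((hv.add h1).add ((hw.add h1).add ((hv.add hw).add h1))))))
  · have x₁ := Frag.exec_drain (τ := τ) (Γ := Γ) (a := inp) (G := R) .inl (b := aux) e₁
      (by simp [inp, aux]) init (st (update (emp _) (.inl false) (u i)) (emp _))
    have x₂ := Frag.exec_drain₂ (τ := τ) (Γ := Γ) (a := aux) (G := R) .inl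
      (b := .inr (.inl M.tm.k₀)) (fun o => M.inputAlphabet.symm (e₁ o))
      (c := .inr (.inr N.tm.k₀)) (fun o => N.inputAlphabet.symm (e₁ o))
      (by simp [aux]) (by simp [aux]) (by simp)
      init (st (update (emp _) (.inl true) (u i).reverse) (emp _))
    have x₃ := ((hM i).left N.tm.initialState
      (update (emp N.tm.Γ) N.tm.k₀ ((u i).map N.inputAlphabet.symm))).right (none : Option R)
      (emp Δ)
    have x₄ := ((hN i).right M.tm.initialState
      (update (emp M.tm.Γ) M.tm.k₁ ((v i).map M.outputAlphabet.symm))).right (none : Option R)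
      (emp Δ)
    have x₅ := Frag.exec_drain (τ := τ) (Γ := Γ) (a := .inr (.inl M.tm.k₁)) (G := R)
      (fun x => .inr (.inl (M.outputAlphabet x))) (b := mid) e₂ (by simp [mid]) init
      (st (emp _) (st (update (emp _) M.tm.k₁ ((v i).map M.outputAlphabet.symm))
        (update (emp _) N.tm.k₁ ((w i).map N.outputAlphabet.symm))))
    have x₆ := Frag.exec_drain (τ := τ) (Γ := Γ) (a := .inr (.inr N.tm.k₁)) (G := R)
      (fun x => .inr (.inr (N.outputAlphabet x))) (b := mid) e₂ (by simp [mid]) init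
      (st (update (emp _) (.inr false) ((v i).map .inl).reverse)
        (st (emp _) (update (emp _) N.tm.k₁ ((w i).map N.outputAlphabet.symm))))
    have x₇ := Frag.exec_drain (τ := τ) (Γ := Γ) (a := mid) (G := R) .inr (b := out) e₂
      (by simp [mid, out]) init
      (st (update (emp _) (.inr false) (((w i).map .inr).reverse ++ ((v i).map .inl).reverse))
        (emp _))
    simp [Γ, Δ, init, inp, aux, mid, out, e₁, e₂, comp_def] at x₁ x₂ x₃ x₄ x₅ x₆ x₇
    have x₇ := x₇.mono (t' := (v i).length + (w i).length + 1) (by omega)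
    have := x₁.seq (x₂.seq (x₃.seq (x₄.seq (x₅.seq (x₆.seq x₇)))))
    simpa [pairStr, inp, out, Γ, Δ, init] using this

/-- A machine is run on its own output as long as the first symbol satisfies `p`. If `s i n` is
the string before round `n` and there are `N i` rounds, this takes polynomial time when the number
of rounds and the lengths of all the strings are polynomially bounded. -/
theorem loop [Fintype A] [Inhabited A] {N : ι → ℕ} {s : ι → ℕ → List A} (p : Option A → Bool)
    (hs : PT (fun j : {j : ι × ℕ // j.2 < N j.1} => s j.1.1 j.1.2) fun j => s j.1.1 (j.1.2 + 1))
    (hp : ∀ i, ∀ n < N i, p (s i n).head? = true) (hpN : ∀ i, p (s i (N i)).head? = false)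
    {b : ι → ℕ} (hsb : ∀ i, ∀ n ≤ N i, (s i n).length ≤ b i)
    (hN : PolyBdd (fun i => (s i 0).length) N) (hb : PolyBdd (fun i => (s i 0).length) b) :
    PT (fun i => s i 0) fun i => s i (N i) := by
  obtain ⟨M, q, hM⟩ := hs
  let Γ := SumFam (fun _ : Unit => A) M.tm.Γ
  -- the register also records the outcome of the test
  let R := Option A
  let d₁ : Frag Γ (R × M.tm.σ) :=
    .drain (.inr M.tm.k₁) M.outputAlphabet (.inl ()) (fun o => o.getD default)
  let d₂ : Frag Γ (R × M.tm.σ) :=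
    .drain (.inl ()) id (.inr M.tm.k₀) (fun o => M.inputAlphabet.symm (o.getD default))
  let F : Frag Γ (R × M.tm.σ) := ((machineFrag M.tm).right (fun _ : Unit => A) R).seq (d₁.seq d₂)
  let S : ι → ℕ → ∀ k, List (Γ k) := fun i n =>
    st (emp _) (update (emp _) M.tm.k₀ ((s i n).map M.inputAlphabet.symm))
  refine of_frag (.loop (.inr M.tm.k₀) (fun o => p (o.map M.inputAlphabet)) (some default) none
      Option.isSome F) (.inr M.tm.k₀) (.inr M.tm.k₀) M.inputAlphabet M.inputAlphabet
    (none, M.tm.initialState)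
    (t := fun i => N i * ((q.eval (b i) + ((b i + 1) + (b i + 1))) + 1) + 1) ?_ fun i => ?_
  · have h1 := fun {t : ι → ℕ} => PolyBdd.const t 1
    exact (hN.mul (((hb.eval q).add ((hb.add h1).add (hb.add h1))).add h1)).add h1
  · have := Frag.exec_loop (Γ := Γ) (R := R) (k := .inr M.tm.k₀)
      (p := fun o => p (o.map M.inputAlphabet)) (c₁ := some default) (c₀ := none)
      (b := Option.isSome) rfl rfl (F := F) (w := M.tm.initialState) (N := N i) (S := S i)
      (T := q.eval (b i) + ((b i + 1) + (b i + 1))) ?_ ?_ ?_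
    · simpa [S, Γ] using this
    · intro n hn
      have e₁ := ((hM ⟨(i, n), hn⟩).right (none : R) (emp fun _ : Unit => A))
      have e₂ := Frag.exec_drain (τ := M.tm.σ) (Γ := Γ) (a := .inr M.tm.k₁)
        M.outputAlphabet (b := .inl ()) (fun o => o.getD default) (by simp)
        (none, M.tm.initialState)
        (st (emp _) (update (emp _) M.tm.k₁ ((s i (n + 1)).map M.outputAlphabet.symm)))
      have e₃ := Frag.exec_drain (τ := M.tm.σ) (Γ := Γ) (a := .inl ())
        id (b := .inr M.tm.k₀) (fun o => M.inputAlphabet.symm (o.getD default)) (by simp)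
        (none, M.tm.initialState)
        (st (update (emp _) () (s i (n + 1)).reverse) (emp _))
      simp [Γ] at e₁ e₂ e₃
      have := (e₁.seq (e₂.seq e₃)).mono (t' := q.eval (b i) + ((b i + 1) + (b i + 1)))
        (add_le_add (eval_mono q (hsb i n hn.le)) (add_le_add
          (Nat.succ_le_succ (hsb i _ hn)) (Nat.succ_le_succ (hsb i _ hn))))
      simpa [S] using this
    · intro n hn
      simpa [S, Option.map_map] using hp i n hn
    · simpa [S, Option.map_map] using hpN i

end PT

/-! ### Transducers -/

/-- The output of a finite transducer: in state `s` and reading `a` it emits `(δ s a).2` and goes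
to state `(δ s a).1`; at the end of the input it emits `fin s`. -/
def transduce {S A B : Type} (δ : S → A → S × List B) (fin : S → List B) : S → List A → List B
  | s, [] => fin s
  | s, a :: l => (δ s a).2 ++ transduce δ fin (δ s a).1 l

section

variable {K : Type} [DecidableEq K] {Γ : K → Type} {Λ σ : Type}

/-- Push the symbols of a list, the first one first. -/
def pushAll (k : K) (l : List (Γ k)) (q : TM2.Stmt Γ Λ σ) : TM2.Stmt Γ Λ σ :=
  l.foldr (fun d q => .push k (fun _ => d) q) q

theorem stepAux_pushAll (k : K) (l : List (Γ k)) (q : TM2.Stmt Γ Λ σ) (v : σ)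
    (S : ∀ k, List (Γ k)) :
    TM2.stepAux (pushAll k l q) v S = TM2.stepAux q v (update S k (l.reverse ++ S k)) := by
  induction l generalizing S with
  | nil => simp [pushAll]
  | cons d l ih =>
    simp only [pushAll, List.foldr_cons, TM2.stepAux] at ih ⊢
    rw [ih]
    simp

/-- Run a transducer on stack `a`, collecting its output on stack `b` (in reverse order). -/
def transduceFrag {G τ S A B : Type} [Fintype S] [Fintype A] (δ : S → A → S × List B)
    (fin : S → List B) (s₀ : S) (a b : K) (fa : Γ a → A) (fb : B → Γ b) (toG : A → G)
    (ofG : G → Option A) : Frag Γ (Option G × τ) where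
  Λ := S ⊕ (S × Option A)
  entry := .inl s₀
  m
    | .inl s => .pop a (fun v o => (o.map fun x => toG (fa x), v.2))
        (.goto fun v => .inr (s, v.1.bind ofG))
    | .inr (s, some x) => pushAll b ((δ s x).2.map fb) (.goto fun _ => .inl (δ s x).1)
    | .inr (s, none) => pushAll b ((fin s).map fb) (.load (fun v => (none, v.2)) .halt)

theorem exec_transduceFrag {G τ S A B : Type} [Fintype S] [Fintype A] (δ : S → A → S × List B)
    (fin : S → List B) (s₀ : S) (a b : K) (hab : a ≠ b) (fa : Γ a → A) (fb : B → Γ b) (toG : A → G)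
    (ofG : G → Option A) (hG : ∀ x, ofG (toG x) = some x) (v : Option G × τ)
    (s : ∀ k, List (Γ k)) :
    (transduceFrag δ fin s₀ a b fa fb toG ofG).Exec (2 * (s a).length + 2) v s (none, v.2)
      (update (update s a []) b (((transduce δ fin s₀ ((s a).map fa)).map fb).reverse ++ s b)) := by
  refine ⟨_, le_rfl, ?_⟩
  have key : ∀ (l : List (Γ a)) (s₁ : S) (v : Option G × τ) (s : ∀ k, List (Γ k)), s a = l →
      StepsTo (transduceFrag (τ := τ) δ fin s₀ a b fa fb toG ofG).m (2 * l.length + 2)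
        ⟨some (.inl s₁), v, s⟩ ⟨none, (none, v.2),
          update (update s a []) b (((transduce δ fin s₁ (l.map fa)).map fb).reverse ++ s b)⟩ := by
    intro l
    induction l with
    | nil =>
      intro s₁ v s hs
      refine .head (.head ?_)
      have h1 : update s a [] = s := by rw [← hs, update_eq_self]
      have h0 := StepsTo.refl (m := (transduceFrag (τ := τ) δ fin s₀ a b fa fb toG ofG).m)
        ⟨none, (none, v.2), update s b (((fin s₁).map fb).reverse ++ s b)⟩
      simpa [transduceFrag, hs, h1, stepAux_pushAll, transduce] using h0
    | cons x l ih =>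
      intro s₁ v s hs
      refine .head (.head ?_)
      have h := ih (δ s₁ (fa x)).1 (some (toG (fa x)), v.2)
        (update (update s a l) b (((δ s₁ (fa x)).2.map fb).reverse ++ s b)) (by simp [hab])
      have h2 : ∀ y z, update (update (update (update s a l) b y) a []) b z =
          update (update s a []) b z := by
        intro y z
        rw [update_comm hab.symm, update_idem, update_idem]
      simp only [h2] at h
      simpa [transduceFrag, hs, hG, stepAux_pushAll, update_of_ne hab.symm, transduce, mul_add] using h
  exact key _ _ _ _ rfl

end

theorem exists_length_transduce_le {S A B : Type} [Finite S] [Finite A] (δ : S → A → S × List B)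
    (fin : S → List B) :
    ∃ c, ∀ s l, (transduce δ fin s l).length ≤ c * (l.length + 1) := by
  obtain ⟨c₁, h₁⟩ := (Set.finite_range fun x : S × A => (δ x.1 x.2).2.length).bddAbove
  obtain ⟨c₂, h₂⟩ := (Set.finite_range fun x : S => (fin x).length).bddAbove
  refine ⟨c₁ + c₂, fun s l => ?_⟩
  induction l generalizing s with
  | nil => simpa [transduce] using (h₂ ⟨s, rfl⟩).trans (Nat.le_add_left _ _)
  | cons a l ih =>
    have := h₁ ⟨(s, a), rfl⟩
    have := ih (δ s a).1
    simp only [transduce, List.length_append, List.length_cons] at *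
    rw [mul_add _ (l.length + 1)]
    omega

/-- Transducers work in linear time. -/
theorem PT.transduce {ι S A B : Type} [Fintype S] [Fintype A] [Fintype B] [Inhabited B]
    (δ : S → A → S × List B) (fin : S → List B) (s₀ : S) (u : ι → List A) :
    PT u fun i => transduce δ fin s₀ (u i) := by
  let Γ := SumFam (fun _ : Unit => A) (fun _ : Bool => B)
  let F₁ : Frag Γ (Option (A ⊕ B) × Unit) := transduceFrag δ fin s₀ (.inl ()) (.inr false) id id
    .inl Sum.getLeft?
  let e : Option (A ⊕ B) → B := fun o => (o.bind Sum.getRight?).getD default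
  let F₂ : Frag Γ (Option (A ⊕ B) × Unit) := .drain (.inr false) .inr (.inr true) e
  obtain ⟨c, hc⟩ := exists_length_transduce_le δ fin
  refine of_frag (F₁.seq F₂) (.inl ()) (.inr true) (.refl _) (.refl _) (none, ())
    (t := fun i => (2 * (u i).length + 2) + (c * ((u i).length + 1) + 1)) ?_ fun i => ?_
  · have hu := PolyBdd.refl fun i => (u i).length
    exact (((PolyBdd.const _ 2).mul hu).add (.const _ 2)).add
      (((PolyBdd.const _ c).mul (hu.add (.const _ 1))).add (.const _ 1))
  · have e₁ := exec_transduceFrag (Γ := Γ) (τ := Unit) (G := A ⊕ B) δ fin s₀ (.inl ())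
      (.inr false) (by simp) id id .inl Sum.getLeft? (fun _ => rfl) (none, ())
      (st (update (emp _) () (u i)) (emp _))
    have e₂ := Frag.exec_drain (Γ := Γ) (τ := Unit) (G := A ⊕ B) (a := .inr false) .inr
      (b := .inr true) e (by simp) (none, ())
      (st (emp _) (update (emp _) false (PolyTM.transduce δ fin s₀ (u i)).reverse))
    simp [Γ, e] at e₁ e₂
    have := (e₁.seq (e₂.mono (t' := c * ((u i).length + 1) + 1)
      (Nat.succ_le_succ (hc s₀ (u i)))))
    simpa [Γ, F₁, F₂, e] using this

end PolyTM

/-! ### Encodings of structured data -/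

namespace PolyTM

open Turing Function Computability

/-- Data encoded as strings over a finite alphabet, which may depend on the type of the data. -/
class Enc (α : Type) where
  L : Type
  [fin : Fintype L]
  [inh : Inhabited L]
  enc : α → List L

attribute [reducible] Enc.fin Enc.inh
attribute [instance] Enc.fin Enc.inh

open Enc (enc)

/-- The length of the encoding. -/
def size {α : Type} [Enc α] (a : α) : ℕ := (enc a).length

instance : Enc Bool where
  L := Bool
  enc b := [b]

instance {α β : Type} [Enc α] [Enc β] : Enc (α × β) where
  L := Enc.L α ⊕ Enc.L β
  enc p := pairStr (enc p.1) (enc p.2)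

/-- The elements of a list are terminated by `none`. -/
instance {α : Type} [Enc α] : Enc (List α) where
  L := Option (Enc.L α)
  enc l := l.flatMap fun a => (enc a).map some ++ [none]

/-- A number is encoded as the list of its binary digits. -/
instance : Enc ℕ where
  L := Option Bool
  enc n := enc (encodeNat n)

/-- A term as a pair: whether it is a variable, and its name. -/
def termPair : Term → Bool × ℕ
  | .var x => (true, x)
  | .const c => (false, c)

instance : Enc Term where
  L := Enc.L (Bool × ℕ)
  enc t := enc (termPair t)

instance {T : Type} [Enc T] : Enc (RelAtom T) where
  L := Enc.L (ℕ × List T)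
  enc a := enc (a.rel, a.args)

section

variable {α β : Type} [Enc α] [Enc β]

theorem size_pair (a : α) (b : β) : size (a, b) = size a + size b := by
  simp [size, enc, pairStr]

@[simp] theorem size_nil : size ([] : List α) = 0 := rfl

@[simp] theorem size_bool (b : Bool) : size b = 1 := rfl

theorem enc_cons (a : α) (l : List α) : enc (a :: l) = (enc a).map some ++ none :: enc l := by
  simp [enc]

theorem enc_append (l l' : List α) : enc (l ++ l') = enc l ++ enc l' := by
  simp [enc]

@[simp] theorem size_cons (a : α) (l : List α) : size (a :: l) = size a + 1 + size l := by
  simp [size, enc_cons]; omega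

@[simp] theorem size_append (l l' : List α) : size (l ++ l') = size l + size l' := by
  simp [size, enc_append]

theorem length_le_size (l : List α) : l.length ≤ size l := by
  induction l with
  | nil => simp
  | cons a l ih => simp; omega

theorem size_le_of_mem {a : α} {l : List α} (h : a ∈ l) : size a ≤ size l := by
  induction l with
  | nil => simp at h
  | cons b l ih =>
    rcases List.mem_cons.1 h with rfl | h
    · simp; omega
    · have := ih h; simp; omega

theorem size_drop_le (l : List α) (n : ℕ) : size (l.drop n) ≤ size l := by
  conv_rhs => rw [← List.take_append_drop n l, size_append]
  omega

theorem size_tail_le (l : List α) : size l.tail ≤ size l := by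
  rw [← List.drop_one]; exact size_drop_le l 1

theorem size_le_mul {l : List α} {n m : ℕ} (hl : l.length ≤ n) (hm : ∀ a ∈ l, size a ≤ m) :
    size l ≤ n * (m + 1) := by
  refine le_trans ?_ (Nat.mul_le_mul_right _ hl)
  clear hl
  induction l with
  | nil => simp
  | cons a l ih =>
    have := ih fun b hb => hm b (by simp [hb])
    have := hm a (by simp)
    simp only [size_cons, List.length_cons, add_mul]
    omega

end

/-! ### Polynomial time functions on structured data -/

/-- The datum `y` is computable from the datum `x` in polynomial time. -/
def CP {ι α β : Type} [Enc α] [Enc β] (x : ι → α) (y : ι → β) : Prop :=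
  PT (fun i => enc (x i)) fun i => enc (y i)

theorem transduce_flatMap {A B : Type} (g : A → List B) (l : List A) :
    transduce (fun _ a => ((), g a)) (fun _ => []) () l = l.flatMap g := by
  induction l with
  | nil => rfl
  | cons a l ih => simp [transduce, ih]

theorem flatMap_nil {A B : Type} (l : List A) : l.flatMap (fun _ => ([] : List B)) = [] := by
  simp

theorem PT.flatMap {ι A B : Type} [Fintype A] [Fintype B] [Inhabited B] (g : A → List B)
    (u : ι → List A) : PT u fun i => (u i).flatMap g := by
  simpa only [transduce_flatMap] using PT.transduce (fun _ a => ((), g a)) (fun _ => []) () u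

namespace CP

variable {ι κ α β γ δ : Type} [Enc α] [Enc β] [Enc γ] [Enc δ] {x : ι → α} {y : ι → β} {z : ι → γ}

theorem reindex (h : CP x y) (f : κ → ι) : CP (fun k => x (f k)) fun k => y (f k) :=
  PT.reindex h f

theorem comp (h : CP x y) (h' : CP y z) : CP x z := PT.comp h h'

theorem pair (h : CP x y) (h' : CP x z) : CP x fun i => (y i, z i) := PT.pair h h'

theorem size_le (h : CP x y) : PolyBdd (fun i => size (x i)) fun i => size (y i) := PT.length_le h

protected theorem id (x : ι → α) : CP x x := by
  have := PT.flatMap (fun a => [a]) fun i => enc (x i)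
  simp only [List.flatMap_singleton'] at this
  exact this

/-- Substitute `y` for the argument of a function. -/
theorem app {f : β → γ} (hf : CP id f) (h : CP x y) : CP x fun i => f (y i) :=
  h.comp (hf.reindex y)

theorem fst {y : ι → β × γ} (h : CP x y) : CP x fun i => (y i).1 := by
  refine h.comp ?_
  have := PT.flatMap (Sum.elim (fun a => [a]) fun _ => []) fun i => enc (y i)
  simpa [enc, pairStr, CP, List.flatMap_map, flatMap_nil] using this

theorem snd {y : ι → β × γ} (h : CP x y) : CP x fun i => (y i).2 := by
  refine h.comp ?_
  have := PT.flatMap (Sum.elim (fun _ => []) fun a => [a]) fun i => enc (y i)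
  simpa [enc, pairStr, CP, List.flatMap_map, flatMap_nil] using this

theorem const (x : ι → α) (b : β) : CP x fun _ => b := by
  have := PT.transduce (fun _ _ => ((), [])) (fun _ => enc b) () fun i => enc (x i)
  have h : ∀ l : List (Enc.L α), transduce (fun (_ : Unit) (_ : Enc.L α) => ((), []))
      (fun _ => enc b) () l = enc b := by
    intro l
    induction l with
    | nil => rfl
    | cons a l ih => simpa [transduce] using ih
  simp only [h] at this
  exact this

theorem singleton (h : CP x y) : CP x fun i => [y i] := by
  refine h.comp ?_
  have := PT.transduce (fun _ a => ((), [some a])) (fun _ => [none]) () fun i => enc (y i)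
  have h : ∀ l : List (Enc.L β), transduce (fun _ a => ((), [some a])) (fun _ => [none]) () l =
      l.map some ++ [none] := by
    intro l
    induction l with
    | nil => rfl
    | cons a l ih => simpa [transduce] using ih
  simpa [h, CP, enc] using this

theorem append {y z : ι → List β} (h : CP x y) (h' : CP x z) : CP x fun i => y i ++ z i := by
  refine (h.pair h').comp ?_
  have := PT.flatMap (Sum.elim (fun a => [a]) fun a => [a]) fun i => enc (y i, z i)
  simpa [enc, pairStr, CP, List.flatMap_map, flatMap_nil] using this

theorem cons {z : ι → List β} (h : CP x y) (h' : CP x z) : CP x fun i => y i :: z i :=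
  h.singleton.append h'

theorem tail {y : ι → List β} (h : CP x y) : CP x fun i => (y i).tail := by
  refine h.comp ?_
  let f : Bool → Option (Enc.L β) → Bool × List (Option (Enc.L β))
    | false, some _ => (false, [])
    | false, none => (true, [])
    | true, a => (true, [a])
  have := PT.transduce f (fun _ => []) false fun i => enc (y i)
  have h₁ : ∀ l, transduce f (fun _ => []) true l = l := by
    intro l
    induction l with
    | nil => rfl
    | cons a l ih => simpa [transduce, f] using ih
  have h₂ : ∀ (l : List (Enc.L β)) l', transduce f (fun _ => []) false (l.map some ++ none :: l') =
      l' := by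
    intro l l'
    induction l with
    | nil => simp [transduce, f, h₁]
    | cons a l ih => simpa [transduce, f] using ih
  have h₃ : ∀ l : List β, transduce f (fun _ => []) false (enc l) = enc l.tail := by
    intro l
    cases l with
    | nil => rfl
    | cons a l => rw [enc_cons, h₂, List.tail_cons]
  simp only [h₃] at this
  exact this

theorem headD {y : ι → List β} (h : CP x y) (d : β) : CP x fun i => (y i).headD d := by
  refine h.comp ?_
  -- the state records whether some symbol, and whether a terminator has been read
  let f : Option Bool → Option (Enc.L β) → Option Bool × List (Enc.L β)
    | some true, _ => (some true, [])
    | _, some a => (some false, [a])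
    | _, none => (some true, [])
  let fin : Option Bool → List (Enc.L β)
    | none => enc d
    | _ => []
  have := PT.transduce f fin none fun i => enc (y i)
  have h₁ : ∀ l, transduce f fin (some true) l = [] := by
    intro l
    induction l with
    | nil => rfl
    | cons a l ih => simpa [transduce, f] using ih
  have h₂ : ∀ (l : List (Enc.L β)) l', transduce f fin (some false) (l.map some ++ none :: l') =
      l := by
    intro l l'
    induction l with
    | nil => simp [transduce, f, h₁]
    | cons a l ih => simpa [transduce, f] using ih
  have h₂' : ∀ (l : List (Enc.L β)) l', transduce f fin none (l.map some ++ none :: l') =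
      l := by
    intro l l'
    cases l with
    | nil => simp [transduce, f, h₁]
    | cons a l => simpa [transduce, f] using h₂ l l'
  have h₃ : ∀ l : List β, transduce f fin none (enc l) = enc (l.headD d) := by
    intro l
    cases l with
    | nil => rfl
    | cons a l => rw [enc_cons, h₂', List.headD_cons]
  simp only [h₃] at this
  exact this

theorem isEmpty {y : ι → List β} (h : CP x y) : CP x fun i => (y i).isEmpty := by
  refine h.comp ?_
  let f : Bool → Option (Enc.L β) → Bool × List Bool := fun _ _ => (false, [])
  have := PT.transduce f (fun s => [s]) true fun i => enc (y i)
  have h₁ : ∀ s l, transduce f (fun s => [s]) s l = [s && l.isEmpty] := by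
    intro s l
    induction l generalizing s with
    | nil => simp [transduce]
    | cons a l ih => simp [transduce, f, ih]
  have h₂ : ∀ l : List β, (enc l).isEmpty = l.isEmpty := by
    intro l
    cases l with
    | nil => rfl
    | cons a l => simp [enc_cons]
  simp only [h₁, h₂] at this
  exact this

theorem cond {c : ι → Bool} {y z : ι → β} (hc : CP x c) (hy : CP x y) (hz : CP x z) :
    CP x fun i => bif c i then y i else z i := by
  refine (hc.pair (hy.pair hz)).comp ?_
  let f : Bool → Bool ⊕ (Enc.L β ⊕ Enc.L β) → Bool × List (Enc.L β)
    | _, .inl c => (c, [])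
    | true, .inr (.inl a) => (true, [a])
    | true, .inr (.inr _) => (true, [])
    | false, .inr (.inl _) => (false, [])
    | false, .inr (.inr a) => (false, [a])
  have := PT.transduce f (fun _ => []) true fun i => enc (c i, (y i, z i))
  have h : ∀ c (a b : List (Enc.L β)), transduce f (fun _ => []) c
      (a.map (fun x => .inr (.inl x)) ++ b.map fun x => .inr (.inr x)) = bif c then a else b := by
    intro c a b
    induction a with
    | nil =>
      induction b with
      | nil => cases c <;> rfl
      | cons x b ih => cases c <;> simpa [transduce, f] using ih
    | cons x a ih => cases c <;> simpa [transduce, f] using ih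
  have h' : ∀ i, transduce f (fun _ => []) true (enc (c i, (y i, z i))) =
      enc (bif c i then y i else z i) := by
    intro i
    have := h (c i) (enc (y i)) (enc (z i))
    simp [enc, pairStr, transduce, f, comp_def] at this ⊢
    rw [this]
    cases c i <;> rfl
  simp only [h'] at this
  exact this

end CP

end PolyTM

/-! ### List recursion in polynomial time -/

namespace PolyTM

open Turing Function Computability
open Enc (enc)

namespace CP

variable {ι κ α β γ δ : Type} [Enc α] [Enc β] [Enc γ] [Enc δ] {x : ι → α} {y : ι → β} {z : ι → γ}

/-- Recursion along the list `l`, where `acc i n` is the value after the first `n` elements. The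
step has to be computable only for the values that do occur, and only their sizes have to be
polynomially bounded. -/
theorem iterate {l : ι → List γ} {acc : ι → ℕ → β} {b : ι → ℕ} (d : γ) (hl : CP x l)
    (h₀ : CP x fun i => acc i 0)
    (hstep : CP (fun j : {j : ι × ℕ // j.2 < (l j.1).length} =>
        (x j.1.1, (acc j.1.1 j.1.2, (l j.1.1)[j.1.2]'j.2))) fun j => acc j.1.1 (j.1.2 + 1))
    (hb : PolyBdd (fun i => size (x i)) b)
    (hsize : ∀ i, ∀ n ≤ (l i).length, size (acc i n) ≤ b i) :
    CP x fun i => acc i (l i).length := by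
  -- the elements still to be processed come first, so that the first symbol of the encoding tells
  -- whether there are any
  let s : ι → ℕ → List γ × (α × β) := fun i n => ((l i).drop n, (x i, acc i n))
  have hs0 : CP x fun i => s i 0 := hl.pair ((CP.id x).pair h₀)
  have hx : PolyBdd (fun i => (enc (s i 0)).length) fun i => size (x i) := by
    refine (PolyBdd.refl _).mono fun i => ?_
    change _ ≤ size (s i 0)
    simp only [s, size_pair]
    omega
  have key : PT (fun i => enc (s i 0)) fun i => enc (s i (l i).length) := by
    refine PT.loop (N := fun i => (l i).length) (s := fun i n => enc (s i n))
      (fun o : Option (Enc.L (List γ) ⊕ Enc.L (α × β)) => o.any Sum.isLeft) ?_ ?_ ?_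
      (b := fun i => size (l i) + (size (x i) + b i)) ?_ ?_ ?_
    · change CP (fun j : {j : ι × ℕ // j.2 < (l j.1).length} => s j.1.1 j.1.2)
        fun j => s j.1.1 (j.1.2 + 1)
      have e := CP.id fun j : {j : ι × ℕ // j.2 < (l j.1).length} => s j.1.1 j.1.2
      have e₁ := (e.snd.fst.pair (e.snd.snd.pair (e.fst.headD d)))
      have h : ∀ j : {j : ι × ℕ // j.2 < (l j.1).length},
          ((l j.1.1).drop j.1.2).headD d = (l j.1.1)[j.1.2]'j.2 := by
        intro j
        rw [List.drop_eq_getElem_cons j.2]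
        rfl
      simp only [s, h] at e₁
      have := e.fst.tail.pair (e.snd.fst.pair (e₁.comp hstep))
      simpa only [s, List.tail_drop] using this
    · intro i n hn
      simp only [s, List.drop_eq_getElem_cons hn]
      change Option.any Sum.isLeft (pairStr (enc ((l i)[n] :: (l i).drop (n + 1))) _).head? = true
      rw [enc_cons]
      cases enc (l i)[n] <;> rfl
    · intro i
      simp only [s, List.drop_length]
      change Option.any Sum.isLeft
        (pairStr (enc ([] : List γ)) (pairStr (enc (x i)) _)).head? = false
      have h0 : enc ([] : List γ) = [] := rfl
      rw [h0, pairStr, List.map_nil, List.nil_append]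
      generalize pairStr (enc (x i)) (enc (acc i (l i).length)) = w
      cases w <;> rfl
    · intro i n hn
      change size (s i n) ≤ _
      simp only [s, size_pair]
      exact add_le_add (size_drop_le _ _) (add_le_add le_rfl (hsize i n hn))
    · refine (PolyBdd.refl _).mono fun i => ?_
      change _ ≤ size (s i 0)
      simp only [s, size_pair, List.drop_zero]
      exact (length_le_size _).trans (by omega)
    · exact hx.trans (hl.size_le.add ((PolyBdd.refl _).add hb))
  have : CP (fun i => s i 0) fun i => s i (l i).length := key
  exact (hs0.comp this).snd.snd

/-- A fold is computable if every step adds to the accumulator at most polynomially many symbols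
in terms of the context and the current element. -/
theorem foldl {l : ι → List γ} {b : ι → β} {f : ι → β → γ → β} (d : γ) (hl : CP x l)
    (hb : CP x b) (hf : CP (fun t : ι × (β × γ) => (x t.1, t.2)) fun t => f t.1 t.2.1 t.2.2)
    (p : Polynomial ℕ) (hp : ∀ i a g, size (f i a g) ≤ size a + p.eval (size (x i) + size g)) :
    CP x fun i => (l i).foldl (f i) (b i) := by
  have h := iterate (acc := fun i n => ((l i).take n).foldl (f i) (b i))
    (b := fun i => size (b i) + size (l i) * p.eval (size (x i) + size (l i))) d hl
    (by simpa using hb) ?_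
    (hb.size_le.add (hl.size_le.mul (((PolyBdd.refl _).add hl.size_le).eval p))) ?_
  · simpa using h
  · have := hf.reindex fun j : {j : ι × ℕ // j.2 < (l j.1).length} =>
      (j.1.1, (((l j.1.1).take j.1.2).foldl (f j.1.1) (b j.1.1), (l j.1.1)[j.1.2]'j.2))
    refine Eq.mp ?_ this
    congr 1
    funext j
    simp only
    rw [List.take_succ_eq_append_getElem j.2, List.foldl_append]
    rfl
  · intro i n _
    have : ∀ (l' : List γ) a, (∀ g ∈ l', g ∈ l i) → size (l'.foldl (f i) a) ≤
        size a + l'.length * p.eval (size (x i) + size (l i)) := by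
      intro l'
      induction l' with
      | nil => simp
      | cons g l' ih =>
        intro a hl'
        have h1 := ih (f i a g) fun g' hg' => hl' g' (by simp [hg'])
        have h2 := hp i a g
        have h3 := eval_mono p (Nat.add_le_add_left (size_le_of_mem (hl' g (by simp)))
          (size (x i)))
        simp only [List.foldl_cons, List.length_cons, add_mul] at h1 h2 h3 ⊢
        omega
    refine (this _ _ fun g hg => List.mem_of_mem_take hg).trans ?_
    refine Nat.add_le_add_left (Nat.mul_le_mul_right _ ?_) _
    exact (List.length_take_le' _ _).trans (length_le_size _)

theorem flatMap {l : ι → List γ} {f : ι → γ → List δ} (d : γ) (hl : CP x l)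
    (hf : CP (fun t : ι × γ => (x t.1, t.2)) fun t => f t.1 t.2) :
    CP x fun i => (l i).flatMap (f i) := by
  obtain ⟨p, hp⟩ := hf.size_le
  have e := CP.id fun t : ι × (List δ × γ) => (x t.1, t.2)
  have h := foldl (f := fun i a g => a ++ f i g) d hl (const x []) (e.snd.fst.append
    ((e.fst.pair e.snd.snd).comp (hf.reindex fun t : ι × (List δ × γ) => (t.1, t.2.2)))) p ?_
  · have h' : ∀ i (l : List γ) a, l.foldl (fun a g => a ++ f i g) a = a ++ l.flatMap (f i) := by
      intro i l
      induction l with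
      | nil => simp
      | cons g l ih => intro a; simp [ih]
    simpa [h'] using h
  · intro i a g
    have := hp (i, g)
    rw [size_append]
    simpa [size_pair] using this

theorem map {l : ι → List γ} {f : ι → γ → δ} (d : γ) (hl : CP x l)
    (hf : CP (fun t : ι × γ => (x t.1, t.2)) fun t => f t.1 t.2) :
    CP x fun i => (l i).map (f i) := by
  have := flatMap (f := fun i g => [f i g]) d hl hf.singleton
  simpa only [List.map_eq_flatMap] using this

theorem filter {l : ι → List γ} {f : ι → γ → Bool} (d : γ) (hl : CP x l)
    (hf : CP (fun t : ι × γ => (x t.1, t.2)) fun t => f t.1 t.2) :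
    CP x fun i => (l i).filter (f i) := by
  have := flatMap (f := fun i g => bif f i g then [g] else []) d hl
    (hf.cond (CP.id _).snd.singleton (const _ []))
  have h : ∀ i (l : List γ), l.flatMap (fun g => bif f i g then [g] else []) = l.filter (f i) := by
    intro i l
    induction l with
    | nil => rfl
    | cons g l ih => cases hg : f i g <;> simp [hg, ih]
  simpa only [h] using this

theorem not {c : ι → Bool} (hc : CP x c) : CP x fun i => !(c i) := by
  have := hc.cond (const x false) (const x true)
  have h : ∀ i, (bif c i then false else true) = !(c i) := fun i => by cases c i <;> rfl
  simpa only [h] using this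

theorem and {c c' : ι → Bool} (hc : CP x c) (hc' : CP x c') : CP x fun i => c i && c' i := by
  have := hc.cond hc' (const x false)
  have h : ∀ i, (bif c i then c' i else false) = (c i && c' i) := fun i => by cases c i <;> rfl
  simpa only [h] using this

theorem or {c c' : ι → Bool} (hc : CP x c) (hc' : CP x c') : CP x fun i => c i || c' i := by
  have := hc.cond (const x true) hc'
  have h : ∀ i, (bif c i then true else c' i) = (c i || c' i) := fun i => by cases c i <;> rfl
  simpa only [h] using this

theorem any {l : ι → List γ} {f : ι → γ → Bool} (d : γ) (hl : CP x l)
    (hf : CP (fun t : ι × γ => (x t.1, t.2)) fun t => f t.1 t.2) :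
    CP x fun i => (l i).any (f i) := by
  have := (filter d hl hf).isEmpty.not
  have h : ∀ i, (!((l i).filter (f i)).isEmpty) = (l i).any (f i) := by
    intro i
    rw [Bool.eq_iff_iff]
    simp
  simpa only [h] using this

theorem all {l : ι → List γ} {f : ι → γ → Bool} (d : γ) (hl : CP x l)
    (hf : CP (fun t : ι × γ => (x t.1, t.2)) fun t => f t.1 t.2) :
    CP x fun i => (l i).all (f i) := by
  have := (any (f := fun i g => !f i g) d hl hf.not).not
  simpa only [List.all_eq_not_any_not] using this

end CP

/-- The lists have equal lengths and corresponding elements are related by `r`. -/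
def zipAll {γ δ : Type} (r : γ → δ → Bool) : List γ → List δ → Bool
  | [], [] => true
  | a :: l, b :: l' => r a b && zipAll r l l'
  | _, _ => false

theorem zipAll_beq {γ : Type} [DecidableEq γ] (l l' : List γ) :
    zipAll (fun a b => decide (a = b)) l l' = decide (l = l') := by
  induction l generalizing l' with
  | nil => cases l' <;> simp [zipAll]
  | cons a l ih => cases l' <;> simp [zipAll, ih]

/-- Removal of duplicates. -/
def dedupList {γ : Type} [DecidableEq γ] (l : List γ) : List γ :=
  l.foldl (fun acc g => bif acc.any (fun a => decide (a = g)) then acc else g :: acc) []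

theorem mem_dedupList_aux {γ : Type} [DecidableEq γ] (l : List γ) :
    ∀ acc : List γ, acc.Nodup → (∀ a, a ∈ l.foldl (fun acc g =>
      bif acc.any (fun a => decide (a = g)) then acc else g :: acc) acc ↔ a ∈ acc ∨ a ∈ l) ∧
      (l.foldl (fun acc g =>
        bif acc.any (fun a => decide (a = g)) then acc else g :: acc) acc).Nodup := by
  induction l with
  | nil => intro acc h; simpa using h
  | cons g l ih =>
    intro acc h
    by_cases hg : g ∈ acc
    · have : acc.any (fun a => decide (a = g)) = true := by simpa using hg
      simp only [List.foldl_cons, this, cond_true]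
      refine ⟨fun a => ?_, (ih acc h).2⟩
      rw [(ih acc h).1 a, List.mem_cons]
      constructor
      · tauto
      · rintro (h | rfl | h) <;> tauto
    · have : acc.any (fun a => decide (a = g)) = false := by
        rw [Bool.eq_false_iff]; simpa using hg
      simp only [List.foldl_cons, this, cond_false]
      have ih := ih (g :: acc) (List.nodup_cons.2 ⟨hg, h⟩)
      refine ⟨fun a => ?_, ih.2⟩
      rw [ih.1 a, List.mem_cons, List.mem_cons]
      tauto

@[simp] theorem mem_dedupList {γ : Type} [DecidableEq γ] {l : List γ} {a : γ} :
    a ∈ dedupList l ↔ a ∈ l := by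
  simpa [dedupList] using (mem_dedupList_aux l [] List.nodup_nil).1 a

theorem nodup_dedupList {γ : Type} [DecidableEq γ] (l : List γ) : (dedupList l).Nodup :=
  (mem_dedupList_aux l [] List.nodup_nil).2

/-- Equality on the type is decidable in polynomial time. -/
class PolyEq (γ : Type) [Enc γ] [DecidableEq γ] : Prop where
  cp : CP (id : γ × γ → γ × γ) fun p => decide (p.1 = p.2)

namespace CP

variable {ι κ α β γ δ : Type} [Enc α] [Enc β] [Enc γ] [Enc δ] {x : ι → α} {y : ι → β} {z : ι → γ}

theorem eq [DecidableEq γ] [PolyEq γ] {y z : ι → γ} (hy : CP x y) (hz : CP x z) :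
    CP x fun i => decide (y i = z i) :=
  (hy.pair hz).comp (PolyEq.cp.reindex fun i => (y i, z i))

theorem zipAll {l : ι → List γ} {l' : ι → List δ} {r : ι → γ → δ → Bool} (c : γ) (d : δ)
    (hl : CP x l) (hl' : CP x l')
    (hr : CP (fun t : ι × (γ × δ) => (x t.1, t.2)) fun t => r t.1 t.2.1 t.2.2) :
    CP x fun i => zipAll (r i) (l i) (l' i) := by
  -- fold over the first list, keeping the rest of the second one in the accumulator
  let f : ι → Bool × List δ → γ → Bool × List δ := fun i a g =>
    (a.1 && (!a.2.isEmpty && r i g (a.2.headD d)), a.2.tail)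
  have e := CP.id fun t : ι × ((Bool × List δ) × γ) => (x t.1, t.2)
  have h := foldl (f := f) (b := fun i => (true, l' i)) c hl ((const x true).pair hl')
    ((e.snd.fst.fst.and (e.snd.fst.snd.isEmpty.not.and
      ((e.fst.pair (e.snd.snd.pair (e.snd.fst.snd.headD d))).comp
        (hr.reindex fun t : ι × ((Bool × List δ) × γ) =>
          (t.1, (t.2.2, t.2.1.2.headD d)))))).pair e.snd.fst.snd.tail) 0 ?_
  · have h' : ∀ i (l : List γ) (l' : List δ) b, (((l.foldl (f i) (b, l')).1 &&
        (l.foldl (f i) (b, l')).2.isEmpty) = (b && PolyTM.zipAll (r i) l l')) := by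
      intro i l
      induction l with
      | nil => intro l' b; cases l' <;> simp [PolyTM.zipAll]
      | cons g l ih =>
        intro l' b
        cases l' with
        | nil =>
          rw [List.foldl_cons, show f i (b, []) g = (false, []) by simp [f], ih]
          simp [PolyTM.zipAll]
        | cons a l' =>
          rw [List.foldl_cons, show f i (b, a :: l') g = (b && r i g a, l') by simp [f], ih]
          simp [PolyTM.zipAll, Bool.and_assoc]
    have := h.fst.and h.snd.isEmpty
    simpa only [h', Bool.true_and] using this
  · intro i a g
    have := size_tail_le a.2
    rw [show a = (a.1, a.2) from rfl]
    simp only [f, size_pair, size_bool]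
    omega

theorem dedup [DecidableEq γ] [PolyEq γ] {l : ι → List γ} (d : γ) (hl : CP x l) :
    CP x fun i => dedupList (l i) := by
  have e := CP.id fun t : ι × (List γ × γ) => (x t.1, t.2)
  have e' := CP.id fun t : (ι × (List γ × γ)) × γ => ((x t.1.1, t.1.2), t.2)
  refine foldl d hl (const x []) ((any d e.snd.fst (e'.snd.eq e'.fst.snd.snd)).cond e.snd.fst
    (e.snd.snd.cons e.snd.fst)) (Polynomial.X + 1) ?_
  intro i a g
  cases a.any fun a => decide (a = g)
  · simp; omega
  · simp

end CP

instance : PolyEq Bool where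
  cp := by
    have e := CP.id (id : Bool × Bool → Bool × Bool)
    have := e.fst.cond e.snd e.snd.not
    have h : ∀ p : Bool × Bool, (bif p.1 then p.2 else !p.2) = decide (p.1 = p.2) := by decide
    simpa only [id, h] using this

instance {α β : Type} [Enc α] [Enc β] [DecidableEq α] [DecidableEq β] [PolyEq α] [PolyEq β] :
    PolyEq (α × β) where
  cp := by
    have e := CP.id (id : (α × β) × (α × β) → (α × β) × (α × β))
    have := (e.fst.fst.eq e.snd.fst).and (e.fst.snd.eq e.snd.snd)
    have h : ∀ p : (α × β) × (α × β), (decide (p.1.1 = p.2.1) && decide (p.1.2 = p.2.2)) =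
      decide (p.1 = p.2) := by
      intro p
      rw [Bool.eq_iff_iff]
      simp [Prod.ext_iff]
    simpa only [id, h] using this

instance {α : Type} [Enc α] [DecidableEq α] [PolyEq α] [Inhabited α] : PolyEq (List α) where
  cp := by
    have e := CP.id (id : List α × List α → List α × List α)
    have e' := CP.id fun t : (List α × List α) × (α × α) => (id t.1, t.2)
    have := CP.zipAll (r := fun _ a b => decide (a = b)) default default e.fst e.snd (e'.snd.fst.eq e'.snd.snd)
    simpa only [id, zipAll_beq] using this

/-- Equality is decided in polynomial time if this holds for the images under an injective map
that does not change the encoding. -/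
theorem PolyEq.of_injective {α β : Type} [Enc α] [Enc β] [DecidableEq α] [DecidableEq β]
    [PolyEq β] (f : α → β) (hf : Injective f) (h : CP (id : α → α) f) : PolyEq α where
  cp := by
    have e := CP.id (id : α × α → α × α)
    have := (h.app e.fst).eq (h.app e.snd)
    simpa only [id, hf.eq_iff] using this

theorem cp_encodeNat : CP (id : ℕ → ℕ) encodeNat :=
  CP.id (encodeNat : ℕ → List Bool)

instance : PolyEq ℕ :=
  .of_injective encodeNat (LeftInverse.injective decode_encodeNat) cp_encodeNat

theorem cp_termPair : CP (id : Term → Term) termPair :=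
  CP.id (termPair : Term → Bool × ℕ)

instance : PolyEq Term :=
  .of_injective termPair (by rintro (_ | _) (_ | _) <;> simp [termPair]) cp_termPair

theorem cp_relAtomPair {T : Type} [Enc T] :
    CP (id : RelAtom T → RelAtom T) fun a => (a.rel, a.args) :=
  CP.id fun a : RelAtom T => (a.rel, a.args)

instance : Inhabited Term := ⟨.const 0⟩

instance : Inhabited (RelAtom Term) := ⟨⟨0, []⟩⟩

instance : PolyEq (RelAtom Term) :=
  .of_injective (fun a => (a.rel, a.args))
    (by rintro ⟨_, _⟩ ⟨_, _⟩; simp) cp_relAtomPair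

theorem cp_relAtomMk {T : Type} [Enc T] :
    CP (id : ℕ × List T → ℕ × List T) fun a => RelAtom.mk a.1 a.2 :=
  CP.id (id : ℕ × List T → ℕ × List T)

end PolyTM

/-! ### Reading queries and databases, and writing relations -/

namespace PolyTM

open Turing Function Computability
open Enc (enc)

instance : Fintype Token :=
  .ofEquiv (Bool ⊕ Fin 5)
    { toFun := fun | .inl b => .bit b | .inr 0 => .var | .inr 1 => .const | .inr 2 => .lpar
                   | .inr 3 => .rpar | .inr 4 => .sep
      invFun := fun | .bit b => .inl b | .var => .inr 0 | .const => .inr 1 | .lpar => .inr 2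
                    | .rpar => .inr 3 | .sep => .inr 4
      left_inv := by rintro (b | b); · rfl
                     fin_cases b <;> rfl
      right_inv := by rintro (_ | _) <;> rfl }

instance : Inhabited Token := ⟨.sep⟩

/-- The states of the parser: in a relation name, at the beginning of a list of arguments, and
after the first token of an argument. -/
inductive ParseState
  | rel | start | arg
deriving DecidableEq

instance : Fintype ParseState := ⟨{.rel, .start, .arg}, by rintro (_ | _ | _) <;> decide⟩

/-- The parser for lists of atoms. The end of an argument becomes visible only with the first token
of the next one, so this is when its terminator is emitted. -/
def parseStep : ParseState → Token →
    ParseState × List (Option (Option Bool ⊕ Option (Bool ⊕ Option Bool)))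
  | .rel, .bit b => (.rel, [some (.inl (some b)), some (.inl none)])
  | .rel, .lpar => (.start, [])
  | .start, .rpar => (.rel, [none])
  | .arg, .rpar => (.rel, [some (.inr none), none])
  | .start, .var => (.arg, [some (.inr (some (.inl true)))])
  | .arg, .var => (.arg, [some (.inr none), some (.inr (some (.inl true)))])
  | .start, .const => (.arg, [some (.inr (some (.inl false)))])
  | .arg, .const => (.arg, [some (.inr none), some (.inr (some (.inl false)))])
  | .arg, .bit b => (.arg, [some (.inr (some (.inr (some b)))), some (.inr (some (.inr none)))])
  | s, _ => (s, [])

/-- The parser, as a function on strings. -/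
def parse (s : ParseState) (l : List Token) : List (Enc.L (List (RelAtom Term))) :=
  transduce parseStep (fun _ => []) s l

theorem parse_rel_encNat (n : ℕ) (l : List Token) :
    parse .rel (encNat n ++ l) = (enc n).map (fun x => some (.inl x)) ++ parse .rel l := by
  change parse .rel ((encodeNat n).map Token.bit ++ l) = (enc (encodeNat n)).map _ ++ _
  generalize encodeNat n = w
  induction w with
  | nil => rfl
  | cons b w ih => rw [enc_cons]; simpa [parse, transduce, parseStep, enc] using ih

theorem parse_arg_encNat (n : ℕ) (l : List Token) :
    parse .arg (encNat n ++ l) =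
      (enc n).map (fun x => some (.inr (some (.inr x)))) ++ parse .arg l := by
  change parse .arg ((encodeNat n).map Token.bit ++ l) = (enc (encodeNat n)).map _ ++ _
  generalize encodeNat n = w
  induction w with
  | nil => rfl
  | cons b w ih => rw [enc_cons]; simpa [parse, transduce, parseStep, enc] using ih

theorem parse_start_encTerm (t : Term) (l : List Token) :
    parse .start (encTerm t ++ l) =
      (enc t).map (fun x => some (.inr (some x))) ++ parse .arg l := by
  rcases t with n | n <;>
  · have := parse_arg_encNat n l
    simp only [encTerm, List.cons_append]
    rw [parse, transduce]
    change _ ++ parse .arg _ = _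
    rw [this]
    simp [parseStep, enc, termPair, pairStr, comp_def]

theorem parse_arg_encTerm (t : Term) (l : List Token) :
    parse .arg (encTerm t ++ l) = some (.inr none) ::
      ((enc t).map (fun x => some (.inr (some x))) ++ parse .arg l) := by
  rw [← parse_start_encTerm]
  rcases t with n | n <;> simp [encTerm, parse, transduce, parseStep]

theorem parse_arg_terms (ts : List Term) (l : List Token) :
    parse .arg (ts.flatMap encTerm ++ Token.rpar :: l) = some (.inr none) ::
      ((enc ts).map (fun x => some (.inr x)) ++ none :: parse .rel l) := by
  induction ts with
  | nil => simp [parse, transduce, parseStep, enc]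
  | cons t ts ih =>
    rw [List.flatMap_cons, List.append_assoc, parse_arg_encTerm, ih, enc_cons]
    simp [comp_def]

theorem parse_start_terms (ts : List Term) (l : List Token) :
    parse .start (ts.flatMap encTerm ++ Token.rpar :: l) =
      (enc ts).map (fun x => some (.inr x)) ++ none :: parse .rel l := by
  cases ts with
  | nil => simp [parse, transduce, parseStep, enc]
  | cons t ts =>
    rw [List.flatMap_cons, List.append_assoc, parse_start_encTerm, parse_arg_terms, enc_cons]
    simp [comp_def]

theorem parse_encAtom (a : RelAtom Term) (l : List Token) :
    parse .rel (encAtom a ++ l) = (enc a).map some ++ none :: parse .rel l := by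
  have h := parse_start_terms a.args l
  have h' : parse .rel (Token.lpar :: (a.args.flatMap encTerm ++ Token.rpar :: l)) =
      parse .start (a.args.flatMap encTerm ++ Token.rpar :: l) := rfl
  rw [encAtom, List.append_assoc, parse_rel_encNat]
  simp only [encTerms, List.cons_append, List.append_assoc, List.nil_append]
  rw [h', h]
  simp [enc, pairStr, comp_def]

theorem parse_flatMap_encAtom (l : List (RelAtom Term)) :
    parse .rel (l.flatMap encAtom) = enc l := by
  induction l with
  | nil => rfl
  | cons a l ih => rw [List.flatMap_cons, parse_encAtom, enc_cons, ih]

/-- The transducer that writes lists of tuples of terms. Its state records whether the opening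
parenthesis of the current tuple has been written. -/
def printStep : Bool → Option (Option (Bool ⊕ Option Bool)) → Bool × List Token
  | false, none => (false, [.lpar, .rpar])
  | true, none => (false, [.rpar])
  | false, some (some (.inl v)) => (true, [.lpar, bif v then .var else .const])
  | true, some (some (.inl v)) => (true, [bif v then .var else .const])
  | _, some (some (.inr (some b))) => (true, [.bit b])
  | s, _ => (s, [])

/-- Writing lists of tuples of terms, as a function on strings. -/
def print (s : Bool) (l : List (Enc.L (List (List Term)))) : List Token :=
  transduce printStep (fun _ => []) s l

theorem print_encNat (n : ℕ) (l : List (Enc.L (List (List Term)))) :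
    print true ((enc n).map (fun x => some (some (.inr x))) ++ l) = encNat n ++ print true l := by
  change print true ((enc (encodeNat n)).map _ ++ l) = (encodeNat n).map Token.bit ++ _
  generalize encodeNat n = w
  induction w with
  | nil => rfl
  | cons b w ih => rw [enc_cons]; simpa [print, transduce, printStep, enc] using ih

theorem print_encTerm (t : Term) (s : Bool) (l : List (Enc.L (List (List Term)))) :
    print s ((enc t).map (fun x => some (some x)) ++ l) =
      (bif s then [] else [.lpar]) ++ (encTerm t ++ print true l) := by
  have h : ∀ v n, print s ((enc (v, n)).map (fun x => some (some x)) ++ l) =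
      (bif s then [] else [.lpar]) ++ ((bif v then .var else .const) ::
        (encNat n ++ print true l)) := by
    intro v n
    rw [← print_encNat]
    have : (enc (v, n)).map (fun x => some (some x)) =
      some (some (.inl v)) :: (enc n).map (fun x => some (some (.inr x))) := by
      simp [enc, pairStr, comp_def]
    rw [this]
    cases s <;> simp [print, transduce, printStep]
  rcases t with n | n
  · exact h true n
  · exact h false n

theorem print_terms (ts : List Term) (s : Bool) (l : List (Enc.L (List (List Term)))) :
    print s ((enc ts).map some ++ none :: l) =
      (bif s then [] else [.lpar]) ++ (ts.flatMap encTerm ++ Token.rpar :: print false l) := by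
  induction ts generalizing s with
  | nil => cases s <;> simp [print, transduce, printStep, enc]
  | cons t ts ih =>
    have : (enc (t :: ts)).map some ++ none :: l = (enc t).map (fun x => some (some x)) ++
        (some none :: ((enc ts).map some ++ none :: l)) := by
      rw [enc_cons]; simp [comp_def]
    rw [this, print_encTerm]
    have : print true (some none :: ((enc ts).map some ++ none :: l)) =
      print true ((enc ts).map some ++ none :: l) := rfl
    rw [this, ih]
    simp

theorem print_enc (l : List (List Term)) : print false (enc l) = l.flatMap encTerms := by
  induction l with
  | nil => rfl
  | cons ts l ih => rw [enc_cons, print_terms, ih]; simp [encTerms]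

/-- Keep the part of the input before or after the first separator. The state records whether the
separator has been read. -/
def splitStep (after : Bool) : Bool → Token → Bool × List Token
  | false, .sep => (true, [])
  | s, t => (s, bif s == after then [t] else [])

theorem transduce_splitStep (after : Bool) (l l' : List Token) (h : Token.sep ∉ l) :
    transduce (splitStep after) (fun _ => []) false (l ++ Token.sep :: l') =
      bif after then l' else l := by
  have h₁ : transduce (splitStep after) (fun _ => []) true l' = bif after then l' else [] := by
    clear h
    induction l' with
    | nil => cases after <;> rfl
    | cons t l' ih => cases after <;> cases t <;> simpa [transduce, splitStep] using ih
  induction l with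
  | nil => simpa [transduce, splitStep] using h₁
  | cons t l ih =>
    simp only [List.mem_cons, not_or] at h
    have ih := ih h.2
    cases after <;> cases t <;> simp_all [transduce, splitStep]

theorem sep_notMem_encTerms (ts : List Term) : Token.sep ∉ encTerms ts := by
  simp only [encTerms, List.mem_cons, List.mem_append, List.mem_flatMap]
  rintro (h | ⟨⟨⟩ | ⟨⟩, _, h⟩ | h) <;> simp [encTerm, encNat] at h

theorem sep_notMem_encAtom (a : RelAtom Term) : Token.sep ∉ encAtom a := by
  simp only [encAtom, List.mem_append, not_or]
  exact ⟨by simp [encNat], sep_notMem_encTerms _⟩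

theorem sep_notMem_encCQ (q : CQ) : Token.sep ∉ encCQ q := by
  simp only [encCQ, List.mem_append, List.mem_flatMap, not_or, not_exists, not_and]
  exact ⟨sep_notMem_encTerms _, fun a _ => sep_notMem_encAtom a⟩

/-- A query as a list of atoms, the first of which is the head. The relation name `0` has the empty
encoding, so that the encoding of the query is that of this list. -/
def atomList (q : CQ) : List (RelAtom Term) := ⟨0, q.head⟩ :: q.body

/-- The facts of a database as atoms without variables. -/
def factList (L : List DBFact) : List (RelAtom Term) := L.map fun a => a.map Term.const

theorem encCQ_eq (q : CQ) : encCQ q = (atomList q).flatMap encAtom := by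
  have : encNat 0 = [] := rfl
  simp [encCQ, atomList, encAtom, this]

theorem encFacts_eq (L : List DBFact) : encFacts L = (factList L).flatMap encAtom := by
  simp [encFacts, factList, List.flatMap_map]

theorem PT.parse {ι : Type} (l : ι → List (RelAtom Term)) :
    PT (fun i => (l i).flatMap encAtom) fun i => enc (l i) := by
  have := PT.transduce parseStep (fun _ => []) .rel fun i => (l i).flatMap encAtom
  have h : ∀ i, PolyTM.transduce parseStep (fun _ => []) .rel ((l i).flatMap encAtom) =
    enc (l i) := fun i => parse_flatMap_encAtom _
  simp only [h] at this
  exact this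

theorem PT.print {ι : Type} (l : ι → List (List Term)) :
    PT (fun i => enc (l i)) fun i => (l i).flatMap encTerms := by
  have := PT.transduce printStep (fun _ => []) false fun i => enc (l i)
  have h : ∀ i, PolyTM.transduce printStep (fun _ => []) false (enc (l i)) =
    (l i).flatMap encTerms := fun i => print_enc _
  simp only [h] at this
  exact this

/-! ### The evaluation algorithm -/

/-- Whether a term is a variable. -/
def isVar (t : Term) : Bool := (termPair t).1

/-- Replace the term `x` by `u`. -/
def replaceTerm (x u t : Term) : Term := bif decide (t = x) then u else t

/-- Replace the term `x` by `u` in all atoms. -/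
def replaceAtoms (x u : Term) (p : List (RelAtom Term)) : List (RelAtom Term) :=
  p.map fun a => ⟨a.rel, a.args.map (replaceTerm x u)⟩

/-- The atom agrees with the fact except that its variables may stand for anything. -/
def matchAtom (a f : RelAtom Term) : Bool :=
  decide (a.rel = f.rel) && zipAll (fun t v => isVar t || decide (t = v)) a.args f.args

/-- Every atom of the body (all but the first one of the list) agrees with some fact. -/
def compat (F p : List (RelAtom Term)) : Bool := p.tail.all fun a => F.any fun f => matchAtom a f

/-- The values occurring in a list of facts. -/
def valueList (F : List (RelAtom Term)) : List Term := F.flatMap fun f => f.args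

/-- The variables of the body. -/
def varList (p : List (RelAtom Term)) : List Term := (p.tail.flatMap fun a => a.args).filter isVar

/-- Replace the variable `x` by all values, in all partially instantiated queries of the list `T`,
and keep those which are still compatible with the facts. -/
def nextRound (F : List (RelAtom Term)) (T : List (List (RelAtom Term))) (x : Term) :
    List (List (RelAtom Term)) :=
  dedupList ((T.flatMap fun p => (valueList F).map fun u => replaceAtoms x u p).filter (compat F))

/-- The compatible partial instances of the query `c` in which the first `n` variables have been
replaced by values. -/
def instances (F c : List (RelAtom Term)) (n : ℕ) : List (List (RelAtom Term)) :=
  ((varList c).take n).foldl (nextRound F) ([c].filter (compat F))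

/-- The tuples of the answer. -/
def answerList (F c : List (RelAtom Term)) : List (List Term) :=
  dedupList ((instances F c (varList c).length).map fun p => (p.headD default).args)

namespace CP

variable {ι α : Type} [Enc α] {x : ι → α}

theorem isVar {t : ι → Term} (h : CP x t) : CP x fun i => isVar (t i) := (cp_termPair.app h).fst

theorem rel {T : Type} [Enc T] {a : ι → RelAtom T} (h : CP x a) : CP x fun i => (a i).rel :=
  (cp_relAtomPair.app h).fst

theorem args {T : Type} [Enc T] {a : ι → RelAtom T} (h : CP x a) : CP x fun i => (a i).args :=
  (cp_relAtomPair.app h).snd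

theorem matchAtom {a f : ι → RelAtom Term} (ha : CP x a) (hf : CP x f) :
    CP x fun i => matchAtom (a i) (f i) := by
  have e := CP.id fun t : ι × (Term × Term) => (x t.1, t.2)
  exact (ha.rel.eq hf.rel).and (zipAll (r := fun _ t v => PolyTM.isVar t || decide (t = v))
    default default ha.args hf.args (e.snd.fst.isVar.or (e.snd.fst.eq e.snd.snd)))

theorem compat {F p : ι → List (RelAtom Term)} (hF : CP x F) (hp : CP x p) :
    CP x fun i => compat (F i) (p i) := by
  have e := CP.id fun t : ι × RelAtom Term => (x t.1, t.2)
  have e' := CP.id fun t : (ι × RelAtom Term) × RelAtom Term => ((x t.1.1, t.1.2), t.2)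
  exact all default hp.tail (any (f := fun t f => PolyTM.matchAtom t.2 f) default
    (e.fst.comp (hF.reindex fun t : ι × RelAtom Term => t.1)) (e'.fst.snd.matchAtom e'.snd))

theorem valueList {F : ι → List (RelAtom Term)} (hF : CP x F) : CP x fun i => valueList (F i) := by
  have e := CP.id fun t : ι × RelAtom Term => (x t.1, t.2)
  exact flatMap default hF e.snd.args

theorem varList {p : ι → List (RelAtom Term)} (hp : CP x p) : CP x fun i => varList (p i) := by
  have e := CP.id fun t : ι × RelAtom Term => (x t.1, t.2)
  have e' := CP.id fun t : ι × Term => (x t.1, t.2)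
  exact filter (f := fun _ t => PolyTM.isVar t) default
    (flatMap (f := fun _ (a : RelAtom Term) => a.args) default hp.tail e.snd.args) e'.snd.isVar

theorem replaceTerm : CP (fun t : ((Term × Term) × RelAtom Term) × Term => (id t.1, t.2))
    fun t => replaceTerm t.1.1.1 t.1.1.2 t.2 := by
  have e := CP.id fun t : ((Term × Term) × RelAtom Term) × Term => (id t.1, t.2)
  exact (e.snd.eq e.fst.fst.fst).cond e.fst.fst.snd e.snd

theorem replaceArgs : CP (id : (Term × Term) × RelAtom Term → (Term × Term) × RelAtom Term)
    fun t => t.2.args.map (PolyTM.replaceTerm t.1.1 t.1.2) := by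
  have e := CP.id (id : (Term × Term) × RelAtom Term → (Term × Term) × RelAtom Term)
  exact map (f := fun t => PolyTM.replaceTerm t.1.1 t.1.2) default e.snd.args replaceTerm

theorem replaceAtom : CP (id : (Term × Term) × RelAtom Term → (Term × Term) × RelAtom Term)
    fun t => RelAtom.mk t.2.rel (t.2.args.map (PolyTM.replaceTerm t.1.1 t.1.2)) := by
  have e := CP.id (id : (Term × Term) × RelAtom Term → (Term × Term) × RelAtom Term)
  have := cp_relAtomMk.app (e.snd.rel.pair replaceArgs)
  exact this

theorem substituted {v u : ι → Term} (hv : CP x v) (hu : CP x u) :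
    CP (fun t : ι × RelAtom Term => (x t.1, t.2)) fun t => ((v t.1, u t.1), t.2) := by
  have e := CP.id fun t : ι × RelAtom Term => (x t.1, t.2)
  exact (e.fst.comp ((hv.pair hu).reindex fun t : ι × RelAtom Term => t.1)).pair e.snd

theorem replacedAtom {v u : ι → Term} (hv : CP x v) (hu : CP x u) :
    CP (fun t : ι × RelAtom Term => (x t.1, t.2))
      fun t => RelAtom.mk t.2.rel (t.2.args.map (PolyTM.replaceTerm (v t.1) (u t.1))) :=
  (substituted hv hu).comp (replaceAtom.reindex _)

theorem replaceAtoms {v u : ι → Term} {p : ι → List (RelAtom Term)} (hv : CP x v) (hu : CP x u)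
    (hp : CP x p) : CP x fun i => replaceAtoms (v i) (u i) (p i) :=
  map (γ := RelAtom Term) (δ := RelAtom Term)
    (f := fun i (a : RelAtom Term) => ⟨a.rel, a.args.map (PolyTM.replaceTerm (v i) (u i))⟩)
    default hp (replacedAtom hv hu)

theorem nextRound {F : ι → List (RelAtom Term)} {T : ι → List (List (RelAtom Term))}
    {v : ι → Term} (hF : CP x F) (hT : CP x T) (hv : CP x v) :
    CP x fun i => nextRound (F i) (T i) (v i) := by
  have e := CP.id fun t : ι × List (RelAtom Term) => (x t.1, t.2)
  have e' := CP.id fun t : (ι × List (RelAtom Term)) × Term => ((x t.1.1, t.1.2), t.2)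
  refine dedup default (filter default (flatMap
    (f := fun i p => (PolyTM.valueList (F i)).map fun u => PolyTM.replaceAtoms (v i) u p) default hT
    (map (f := fun t u => PolyTM.replaceAtoms (v t.1) u t.2) default
      (e.fst.comp (hF.valueList.reindex Prod.fst))
      ((e'.fst.fst.comp (hv.reindex fun t : (ι × List (RelAtom Term)) × Term => t.1.1)).replaceAtoms
        e'.snd e'.fst.snd))) ((e.fst.comp (hF.reindex Prod.fst)).compat e.snd))

/-- The algorithm takes polynomial time on inputs for which the lists of partial instances remain
polynomially bounded. -/
theorem answerList {F c : ι → List (RelAtom Term)} {b : ι → ℕ}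
    (hb : PolyBdd (fun i => size (c i, F i)) b)
    (h : ∀ i, ∀ n ≤ (PolyTM.varList (c i)).length, size (instances (F i) (c i) n) ≤ b i) :
    CP (fun i => (c i, F i)) fun i => answerList (F i) (c i) := by
  have e := CP.id fun i => (c i, F i)
  have e' := CP.id fun t : ι × List (RelAtom Term) => ((c t.1, F t.1), t.2)
  have e'' := CP.id fun j : {j : ι × ℕ // j.2 < (PolyTM.varList (c j.1)).length} =>
    ((c j.1.1, F j.1.1), (instances (F j.1.1) (c j.1.1) j.1.2,
      (PolyTM.varList (c j.1.1))[j.1.2]'j.2))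
  refine dedup default (map (f := fun _ (p : List (RelAtom Term)) => (p.headD default).args) default
    (iterate (b := b) default e.fst.varList ?_ ?_ hb h) (e'.snd.headD default).args)
  · exact filter (f := fun i p => PolyTM.compat (F i) p) default e.fst.singleton
      (e'.fst.snd.compat e'.snd)
  · have := e''.fst.snd.nextRound e''.snd.fst e''.snd.snd
    refine Eq.mp ?_ this
    congr 1
    funext j
    simp only [instances]
    rw [List.take_succ_eq_append_getElem j.2, List.foldl_append]
    rfl

end CP

end PolyTM

/-! ### The size bound for joins -/

namespace PolyTM

open Finset

/-- A form of Hölder's inequality for several factors. -/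
theorem sum_prod_rpow_le {ε α : Type} (E : Finset ε) (A : Finset α) (x : ε → ℝ) (n : ε → α → ℝ)
    (hx : ∀ e ∈ E, 0 ≤ x e) (hn : ∀ e ∈ E, ∀ a ∈ A, 0 ≤ n e a) (h1 : 1 ≤ ∑ e ∈ E, x e) :
    ∑ a ∈ A, ∏ e ∈ E, n e a ^ x e ≤ ∏ e ∈ E, (∑ a ∈ A, n e a) ^ x e := by
  let N : ε → ℝ := fun e => ∑ a ∈ A, n e a
  let r : ε → α → ℝ := fun e a => n e a / N e
  let s : ℝ := ∑ e ∈ E, x e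
  have hN : ∀ e ∈ E, 0 ≤ N e := fun e he => sum_nonneg (hn e he)
  have hr0 : ∀ e ∈ E, ∀ a ∈ A, 0 ≤ r e a := fun e he a ha => div_nonneg (hn e he a ha) (hN e he)
  have hle : ∀ e ∈ E, ∀ a ∈ A, n e a ≤ N e := fun e he a ha => single_le_sum (hn e he) ha
  have hr1 : ∀ e ∈ E, ∀ a ∈ A, r e a ≤ 1 := fun e he a ha =>
    div_le_one_of_le₀ (hle e he a ha) (hN e he)
  have hnr : ∀ e ∈ E, ∀ a ∈ A, n e a = N e * r e a := by
    intro e he a ha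
    rcases eq_or_ne (N e) 0 with h | h
    · have := hle e he a ha
      have := hn e he a ha
      rw [h, zero_mul]
      linarith
    · simp only [r]
      field_simp
  have hs : 0 < s := lt_of_lt_of_le one_pos h1
  have hpt : ∀ a ∈ A, ∏ e ∈ E, r e a ^ x e ≤ ∑ e ∈ E, x e / s * r e a := by
    intro a ha
    refine le_trans (prod_le_prod (fun e he => Real.rpow_nonneg (hr0 e he a ha) _) fun e he => ?_)
      (Real.geom_mean_le_arith_mean_weighted E (fun e => x e / s) (fun e => r e a)
        (fun e he => div_nonneg (hx e he) hs.le) (by rw [← sum_div]; exact div_self hs.ne')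
        fun e he => hr0 e he a ha)
    rcases (hr0 e he a ha).eq_or_lt with h0 | h0
    · rcases (hx e he).eq_or_lt with hx0 | hx0
      · simp [← hx0]
      · rw [← h0, Real.zero_rpow hx0.ne', Real.zero_rpow (div_pos hx0 hs).ne']
    · exact Real.rpow_le_rpow_of_exponent_ge h0 (hr1 e he a ha) (div_le_self (hx e he) h1)
  have hsum : ∑ a ∈ A, ∏ e ∈ E, r e a ^ x e ≤ 1 := by
    refine (sum_le_sum hpt).trans ?_
    rw [sum_comm]
    calc ∑ e ∈ E, ∑ a ∈ A, x e / s * r e a ≤ ∑ e ∈ E, x e / s * 1 := by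
          refine sum_le_sum fun e he => ?_
          rw [← mul_sum, ← sum_div]
          exact mul_le_mul_of_nonneg_left (div_self_le_one _) (div_nonneg (hx e he) hs.le)
      _ = 1 := by simp only [mul_one, ← sum_div]; exact div_self hs.ne'
  calc ∑ a ∈ A, ∏ e ∈ E, n e a ^ x e
      = (∏ e ∈ E, N e ^ x e) * ∑ a ∈ A, ∏ e ∈ E, r e a ^ x e := by
        rw [mul_sum]
        refine sum_congr rfl fun a ha => ?_
        rw [← prod_mul_distrib]
        refine prod_congr rfl fun e he => ?_
        rw [← Real.mul_rpow (hN e he) (hr0 e he a ha), ← hnr e he a ha]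
    _ ≤ _ := mul_le_of_le_one_right (prod_nonneg fun e he => Real.rpow_nonneg (hN e he) _) hsum

/-- The assignment `θ` restricted to `A`. -/
def restrict (A : Finset ℕ) (θ : ℕ → ℕ) : ℕ → ℕ := fun v => if v ∈ A then θ v else 0

/-- The number of restrictions to `A` of assignments in `J`. -/
noncomputable def numRestrict (J : Finset (ℕ → ℕ)) (A : Finset ℕ) : ℕ :=
  letI := Classical.decEq (ℕ → ℕ)
  (J.image (restrict A)).card

theorem restrict_eq_iff {A : Finset ℕ} {θ θ' : ℕ → ℕ} :
    restrict A θ = restrict A θ' ↔ ∀ v ∈ A, θ v = θ' v := by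
  constructor
  · intro h v hv
    simpa [restrict, hv] using congrFun h v
  · intro h
    funext v
    by_cases hv : v ∈ A
    · simp [restrict, hv, h v hv]
    · simp [restrict, hv]

theorem numRestrict_mono {J J' : Finset (ℕ → ℕ)} (h : J ⊆ J') (A : Finset ℕ) :
    numRestrict J A ≤ numRestrict J' A := by
  classical
  unfold numRestrict
  exact card_le_card (image_subset_image h)

theorem numRestrict_insert (J : Finset (ℕ → ℕ)) {A : Finset ℕ} {v : ℕ} (hv : v ∉ A) :
    numRestrict J (insert v A) =
      ∑ a ∈ J.image (fun θ => θ v), numRestrict (J.filter fun θ => θ v = a) A := by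
  classical
  have h1 : numRestrict J (insert v A) = (J.image fun θ => (θ v, restrict A θ)).card := by
    unfold numRestrict
    rw [← card_image_of_injOn (f := fun θ : ℕ → ℕ => (θ v, restrict A θ))
      (s := J.image (restrict (insert v A))), image_image]
    · congr 1
      · refine image_congr fun θ _ => ?_
        have : restrict A (restrict (insert v A) θ) = restrict A θ :=
          restrict_eq_iff.2 fun w hw => by simp [restrict, hw]
        simp [this, restrict]
    · intro θ hθ θ' hθ' h
      simp only [coe_image, Set.mem_image] at hθ hθ'
      obtain ⟨τ, -, rfl⟩ := hθ
      obtain ⟨τ', -, rfl⟩ := hθ'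
      simp only [Prod.mk.injEq, restrict_eq_iff] at h
      rw [restrict_eq_iff]
      intro w hw
      rcases mem_insert.1 hw with rfl | hw'
      · simpa [restrict] using h.1
      · simpa [restrict, hw'] using h.2 w hw'
  rw [h1, card_eq_sum_card_fiberwise (f := Prod.fst) (t := J.image fun θ => θ v)]
  · refine sum_congr rfl fun a _ => ?_
    unfold numRestrict
    refine Eq.trans (congrArg card ?_) (card_image_of_injective _ (Prod.mk_right_injective a))
    ext ⟨b, θ⟩
    simp only [mem_filter, mem_image, Prod.mk.injEq]
    constructor
    · rintro ⟨⟨τ, hτ, rfl, rfl⟩, rfl⟩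
      exact ⟨_, ⟨τ, ⟨hτ, rfl⟩, rfl⟩, rfl, rfl⟩
    · rintro ⟨_, ⟨τ, ⟨hτ, rfl⟩, rfl⟩, rfl, rfl⟩
      exact ⟨⟨τ, hτ, rfl, rfl⟩, rfl⟩
  · intro p hp
    simp only [coe_image, Set.mem_image, mem_coe] at hp ⊢
    obtain ⟨θ, hθ, rfl⟩ := hp
    exact ⟨θ, hθ, rfl⟩

/-- The bound of Atserias, Grohe and Marx: if the sets `S e` with the weights `x e` cover `V`
fractionally, then a set of assignments has at most `∏ e, (n e) ^ (x e)` restrictions to `V`, where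
`n e` is the number of its restrictions to `S e`. The assignments are split up by their value at
one variable, and the bounds for the parts are combined by Hölder's inequality. -/
theorem numRestrict_le_prod {ε : Type} (E : Finset ε) (S : ε → Finset ℕ) (x : ε → ℝ)
    (hx : ∀ e ∈ E, 0 ≤ x e) (V : Finset ℕ)
    (hV : ∀ v ∈ V, 1 ≤ ∑ e ∈ E.filter (fun e => v ∈ S e), x e) (J : Finset (ℕ → ℕ)) :
    (numRestrict J V : ℝ) ≤ ∏ e ∈ E, (numRestrict J (S e ∩ V) : ℝ) ^ x e := by
  classical
  induction V using Finset.induction_on generalizing J with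
  | empty =>
    rcases J.eq_empty_or_nonempty with rfl | hJ
    · simp only [numRestrict, image_empty, card_empty, Nat.cast_zero]
      exact prod_nonneg fun e _ => Real.rpow_nonneg le_rfl _
    · have h : numRestrict J ∅ = 1 := by
        have : restrict ∅ = fun _ : ℕ → ℕ => fun _ => 0 := by
          funext θ v; simp [restrict]
        rw [numRestrict, this, image_const hJ, card_singleton]
      simp [h]
  | insert v V hv ih =>
    have ih := ih fun w hw => hV w (mem_insert_of_mem hw)
    set A := J.image fun θ => θ v
    let Ja : ℕ → Finset (ℕ → ℕ) := fun a => J.filter fun θ => θ v = a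
    let E₁ := E.filter fun e => v ∈ S e
    let E₀ := E.filter fun e => v ∉ S e
    have hsplit : ∀ φ : ε → ℝ, ∏ e ∈ E, φ e = (∏ e ∈ E₁, φ e) * ∏ e ∈ E₀, φ e := fun φ =>
      (prod_filter_mul_prod_filter_not E (fun e => v ∈ S e) φ).symm
    have h₁ : ∀ e ∈ E₁, (numRestrict J (S e ∩ insert v V) : ℝ) =
        ∑ a ∈ A, (numRestrict (Ja a) (S e ∩ V) : ℝ) := by
      intro e he
      rw [inter_insert_of_mem (mem_filter.1 he).2, numRestrict_insert J (by simp [hv])]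
      push_cast
      rfl
    have h₀ : ∀ e ∈ E₀, S e ∩ insert v V = S e ∩ V := fun e he =>
      inter_insert_of_notMem (mem_filter.1 he).2
    calc (numRestrict J (insert v V) : ℝ)
        = ∑ a ∈ A, (numRestrict (Ja a) V : ℝ) := by
          rw [numRestrict_insert J hv]; push_cast; rfl
      _ ≤ ∑ a ∈ A, ∏ e ∈ E, (numRestrict (Ja a) (S e ∩ V) : ℝ) ^ x e :=
          sum_le_sum fun a _ => ih (Ja a)
      _ ≤ ∑ a ∈ A, (∏ e ∈ E₁, (numRestrict (Ja a) (S e ∩ V) : ℝ) ^ x e) *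
            ∏ e ∈ E₀, (numRestrict J (S e ∩ V) : ℝ) ^ x e := by
          refine sum_le_sum fun a _ => ?_
          rw [hsplit]
          refine mul_le_mul_of_nonneg_left ?_ (prod_nonneg fun e _ => by positivity)
          refine prod_le_prod (fun e _ => by positivity) fun e he => ?_
          refine Real.rpow_le_rpow (by positivity) ?_ (hx e (mem_filter.1 he).1)
          exact_mod_cast numRestrict_mono (filter_subset _ _) _
      _ = (∑ a ∈ A, ∏ e ∈ E₁, (numRestrict (Ja a) (S e ∩ V) : ℝ) ^ x e) *
            ∏ e ∈ E₀, (numRestrict J (S e ∩ V) : ℝ) ^ x e := by rw [sum_mul]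
      _ ≤ (∏ e ∈ E₁, (∑ a ∈ A, (numRestrict (Ja a) (S e ∩ V) : ℝ)) ^ x e) *
            ∏ e ∈ E₀, (numRestrict J (S e ∩ V) : ℝ) ^ x e := by
          refine mul_le_mul_of_nonneg_right ?_ (prod_nonneg fun e _ => by positivity)
          exact sum_prod_rpow_le E₁ A x _ (fun e he => hx e (mem_filter.1 he).1)
            (fun e _ a _ => by positivity) (hV v (mem_insert_self _ _))
      _ = _ := by
          rw [hsplit]
          congr 1
          · exact prod_congr rfl fun e he => by rw [h₁ e he]
          · exact prod_congr rfl fun e he => by rw [h₀ e he]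

end PolyTM

/-! ### Homomorphisms and cores -/

namespace RelAtom

theorem map_map {R S T : Type} (f : R → S) (g : S → T) (a : RelAtom R) :
    (a.map f).map g = a.map (g ∘ f) := by
  simp [RelAtom.map]

theorem map_congr {S T : Type} {f g : S → T} {a : RelAtom S} (h : ∀ t ∈ a.args, f t = g t) :
    a.map f = a.map g := by
  simp only [RelAtom.map, RelAtom.mk.injEq, true_and]
  exact List.map_congr_left h

theorem map_eq_self {S : Type} {f : S → S} {a : RelAtom S} :
    a.map f = a ↔ ∀ t ∈ a.args, f t = t := by
  rcases a with ⟨r, l⟩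
  simp only [RelAtom.map, RelAtom.mk.injEq, true_and]
  induction l with
  | nil => simp
  | cons t l ih => simp [ih]

end RelAtom

namespace Term

theorem eval_subst (f : ℕ → Term) (σ : ℕ → ℕ) (t : Term) :
    (t.subst f).eval σ = t.eval fun x => (f x).eval σ := by
  cases t <;> rfl

theorem subst_subst (f g : ℕ → Term) (t : Term) :
    (t.subst f).subst g = t.subst fun x => (f x).subst g := by
  cases t <;> rfl

theorem subst_var (t : Term) : t.subst Term.var = t := by
  cases t <;> rfl

end Term

namespace CQ

/-- A homomorphism that maps the head to the head. This is what equivalence of queries provides: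
the heads of equivalent queries may use different variables. -/
def HeadHom (q₁ q₂ : CQ) (f : ℕ → Term) : Prop :=
  q₁.head.map (Term.subst f) = q₂.head ∧ ∀ a ∈ q₁.atoms, a.map (Term.subst f) ∈ q₂.atoms

theorem headHom_var (q : CQ) : HeadHom q q Term.var := by
  refine ⟨?_, fun a ha => ?_⟩
  · rw [List.map_congr_left (g := id) fun t _ => Term.subst_var t, List.map_id]
  · rwa [RelAtom.map_eq_self.2 fun t _ => Term.subst_var t]

theorem IsHom.headHom {q₁ q₂ : CQ} {f : ℕ → Term} (h : IsHom q₁ q₂ f) : HeadHom q₁ q₂ f := by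
  refine ⟨?_, h.2.2⟩
  rw [← h.1]
  have : (⟨0, q₁.head⟩ : RelAtom Term).map (Term.subst f) = ⟨0, q₁.head⟩ := by
    rw [RelAtom.map_eq_self]
    intro t ht
    cases t with
    | var x => exact h.2.1 x ht
    | const c => rfl
  exact congrArg RelAtom.args this

theorem HeadHom.comp {q₁ q₂ q₃ : CQ} {f g : ℕ → Term} (h : HeadHom q₁ q₂ f)
    (h' : HeadHom q₂ q₃ g) : HeadHom q₁ q₃ fun x => (f x).subst g := by
  constructor
  · rw [← h'.1, ← h.1, List.map_map]
    exact List.map_congr_left fun t _ => (Term.subst_subst f g t).symm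
  · intro a ha
    have := h'.2 _ (h.2 a ha)
    rw [RelAtom.map_map] at this
    rwa [RelAtom.map_congr fun t _ => (Term.subst_subst f g t).symm]

theorem HeadHom.answer_subset {q₁ q₂ : CQ} {f : ℕ → Term} (h : HeadHom q₁ q₂ f) (D : Database) :
    q₂.answer D ⊆ q₁.answer D := by
  rintro t ⟨σ, -, hσ, rfl⟩
  have hat : ∀ a ∈ q₁.atoms, a.map (Term.eval fun x => (f x).eval σ) ∈ D := by
    intro a ha
    have := hσ _ (h.2 a ha)
    rw [RelAtom.map_map] at this
    rwa [RelAtom.map_congr fun t _ => (Term.eval_subst f σ t).symm]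
  refine ⟨fun x => (f x).eval σ, ?_, hat, ?_⟩
  · rintro x ⟨a, ha, hx⟩
    exact ⟨_, hat a ha, List.mem_map.2 ⟨_, hx, rfl⟩⟩
  · rw [← h.1, List.map_map]
    exact List.map_congr_left fun t _ => Term.eval_subst f σ t

theorem exists_const_bound (l : List Term) : ∃ M, ∀ c, Term.const c ∈ l → c < M := by
  induction l with
  | nil => exact ⟨0, by simp⟩
  | cons t l ih =>
    obtain ⟨M, hM⟩ := ih
    refine ⟨max M (t.eval id + 1), fun c hc => ?_⟩
    rcases List.mem_cons.1 hc with rfl | h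
    · simp [Term.eval]
    · exact lt_max_of_lt_left (hM c h)

/-- The theorem of Chandra and Merlin: the variables of `q₂` are turned into fresh constants, and
the head of `q₂` is an answer of `q₂`, hence of `q₁`, on the resulting database. -/
theorem exists_headHom {q₁ q₂ : CQ} (h : ∀ D, q₂.answer D ⊆ q₁.answer D) :
    ∃ f, HeadHom q₁ q₂ f := by
  obtain ⟨M, hM⟩ := exists_const_bound (q₁.head ++ q₁.body.flatMap (fun a => a.args) ++
    (q₂.head ++ q₂.body.flatMap (fun a => a.args)))
  have hM₁ : ∀ c, Term.const c ∈ q₁.head → c < M := fun c hc => hM c (by simp [hc])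
  have hM₂ : ∀ c, Term.const c ∈ q₂.head → c < M := fun c hc => hM c (by simp [hc])
  have hA : ∀ q : CQ, q = q₁ ∨ q = q₂ → ∀ a ∈ q.atoms, ∀ c, Term.const c ∈ a.args → c < M := by
    intro q hq a ha c hc
    have ha : a ∈ q.body := List.mem_toFinset.1 ha
    refine hM c ?_
    simp only [List.mem_append, List.mem_flatMap]
    rcases hq with rfl | rfl
    · exact .inl (.inr ⟨a, ha, hc⟩)
    · exact .inr (.inr ⟨a, ha, hc⟩)
  let σ : ℕ → ℕ := fun x => M + x
  let unfreeze : ℕ → Term := fun n => if n < M then .const n else .var (n - M)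
  have hun : ∀ t : Term, (∀ c, t = .const c → c < M) → unfreeze (t.eval σ) = t := by
    rintro (x | c) ht
    · simp [unfreeze, Term.eval, σ]
    · simp [unfreeze, Term.eval, ht c rfl]
  let D : Database := q₂.atoms.image fun a => a.map (Term.eval σ)
  have hD : ∀ a ∈ q₂.atoms, a.map (Term.eval σ) ∈ D := fun a ha => Finset.mem_image_of_mem _ ha
  obtain ⟨τ, -, hτ, hhead⟩ := h D ⟨σ, by
    rintro x ⟨a, ha, hx⟩
    exact ⟨_, hD a ha, List.mem_map.2 ⟨_, hx, rfl⟩⟩, hD, rfl⟩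
  have hsub : ∀ t : Term, (∀ c, t = .const c → c < M) →
      unfreeze (t.eval τ) = t.subst fun x => unfreeze (τ x) := by
    rintro (x | c) ht
    · rfl
    · simp [unfreeze, Term.eval, Term.subst, ht c rfl]
  refine ⟨fun x => unfreeze (τ x), ?_, fun a ha => ?_⟩
  · have := congrArg (List.map unfreeze) hhead
    rw [List.map_map, List.map_map] at this
    rw [← List.map_congr_left fun t ht => hsub t fun c hc => hM₁ c (hc ▸ ht)]
    refine this.symm.trans ?_
    exact (List.map_congr_left (g := id) fun t ht => hun t fun c hc => hM₂ c (hc ▸ ht)).trans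
      (List.map_id _)
  · obtain ⟨b, hb, hab⟩ := Finset.mem_image.1 (hτ a ha)
    have := congrArg (RelAtom.map unfreeze) hab
    have hself : b.map (unfreeze ∘ Term.eval σ) = b := RelAtom.map_eq_self.2 fun t ht =>
      hun t fun c hc => hA q₂ (.inr rfl) b hb c (hc ▸ ht)
    rw [RelAtom.map_map, RelAtom.map_map, hself] at this
    have hself' : a.map (unfreeze ∘ Term.eval τ) = a.map (Term.subst fun x => unfreeze (τ x)) :=
      RelAtom.map_congr fun t ht => hsub t fun c hc => hA q₁ (.inl rfl) a ha c (hc ▸ ht)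
    rw [this, hself'] at hb
    exact hb

/-- The image of a query under an endomorphism. -/
def image (c : CQ) {h : ℕ → Term} (hh : HeadHom c c h) : CQ where
  head := c.head
  body := c.body.map fun a => a.map (Term.subst h)
  safe := by
    intro x hx
    have hx' : Term.var x ∈ c.head.map (Term.subst h) := by rw [hh.1]; exact hx
    obtain ⟨t, ht, htx⟩ := List.mem_map.1 hx'
    cases t with
    | const d => cases htx
    | var y =>
      obtain ⟨a, ha, hay⟩ := c.safe y ht
      exact ⟨_, List.mem_map.2 ⟨a, ha, rfl⟩, List.mem_map.2 ⟨_, hay, htx⟩⟩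

/-- An endomorphism of a core is injective on the atoms, for its image is an equivalent query. -/
theorem IsCore.injOn {c q : CQ} (hc : IsCore c q) {h : ℕ → Term} (hh : HeadHom c c h) :
    Set.InjOn (fun a : RelAtom Term => a.map (Term.subst h)) c.atoms := by
  have hat : (c.image hh).atoms = c.atoms.image fun a => a.map (Term.subst h) := by
    ext a; simp [atoms, image]
  have h₁ : HeadHom c (c.image hh) h :=
    ⟨hh.1, fun a ha => by rw [hat]; exact Finset.mem_image_of_mem _ ha⟩
  have h₂ : HeadHom (c.image hh) c Term.var := by
    refine ⟨?_, fun a ha => ?_⟩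
    · rw [List.map_congr_left (g := id) fun t _ => Term.subst_var t, List.map_id]; rfl
    · rw [hat] at ha
      obtain ⟨b, hb, rfl⟩ := Finset.mem_image.1 ha
      rw [RelAtom.map_eq_self.2 fun t _ => Term.subst_var t]
      exact hh.2 b hb
  have heq : Equivalent (c.image hh) q := fun D =>
    ((h₁.answer_subset D).antisymm (h₂.answer_subset D)).trans (hc.1 D)
  have hcard := hc.2 _ heq
  rw [hat] at hcard
  exact Finset.card_image_iff.1 (le_antisymm Finset.card_image_le hcard)

/-- A core is a retract of every homomorphically equivalent query: a composition of homomorphisms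
back and forth permutes the atoms of the core, so some power of it is the identity. -/
theorem IsCore.exists_retract {c q q' : CQ} (hc : IsCore c q) (hq : HomEquiv q' q) :
    ∃ f g : ℕ → Term, (∀ a ∈ c.atoms, a.map (Term.subst f) ∈ q'.atoms) ∧
      (∀ a ∈ q'.atoms, a.map (Term.subst g) ∈ c.atoms) ∧
      ∀ x ∈ c.vars, (f x).subst g = Term.var x := by
  obtain ⟨⟨f₁, hf₁⟩, ⟨g₁, hg₁⟩⟩ := hq
  obtain ⟨f, hf⟩ := exists_headHom (q₁ := c) (q₂ := q') fun D =>
    (hg₁.headHom.answer_subset D).trans (hc.1 D).symm.subset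
  obtain ⟨g, hg⟩ := exists_headHom (q₁ := q') (q₂ := c) fun D =>
    (hc.1 D).subset.trans (hf₁.headHom.answer_subset D)
  have hh := hf.comp hg
  set h : ℕ → Term := fun x => (f x).subst g
  let H : ℕ → ℕ → Term := fun n => n.rec Term.var fun _ k x => (h x).subst k
  have hH : ∀ n, HeadHom c c (H n) := by
    intro n
    induction n with
    | zero => exact headHom_var c
    | succ n ih => exact hh.comp ih
  let φ : {a // a ∈ c.atoms} → {a // a ∈ c.atoms} := fun a => ⟨a.1.map (Term.subst h), hh.2 _ a.2⟩
  have hφ : Function.Injective φ := fun a b hab =>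
    Subtype.ext (hc.injOn hh a.2 b.2 (congrArg Subtype.val hab))
  have hφH : ∀ n a, (φ^[n] a).1 = a.1.map (Term.subst (H n)) := by
    intro n
    induction n with
    | zero => intro a; exact (RelAtom.map_eq_self.2 fun t _ => Term.subst_var t).symm
    | succ n ih =>
      intro a
      rw [Function.iterate_succ_apply, ih, RelAtom.map_map]
      exact RelAtom.map_congr fun t _ => Term.subst_subst h (H n) t
  let π : Equiv.Perm {a // a ∈ c.atoms} :=
    Equiv.ofBijective φ (Finite.injective_iff_bijective.1 hφ)
  obtain ⟨n, hn⟩ : ∃ n, π ^ (n + 1) = 1 :=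
    ⟨orderOf π - 1, by rw [Nat.sub_add_cancel (orderOf_pos π)]; exact pow_orderOf_eq_one π⟩
  refine ⟨f, fun y => (g y).subst (H n), hf.2, (hg.comp (hH n)).2, ?_⟩
  rintro x ⟨a, ha, hx⟩
  have h₁ : φ^[n + 1] ⟨a, ha⟩ = ⟨a, ha⟩ := by
    have : (π ^ (n + 1)) ⟨a, ha⟩ = ⟨a, ha⟩ := by rw [hn]; rfl
    rwa [Equiv.Perm.coe_pow] at this
  have h₂ := hφH (n + 1) ⟨a, ha⟩
  rw [h₁] at h₂
  have h₃ := RelAtom.map_eq_self.1 h₂.symm _ hx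
  rw [← Term.subst_subst]
  exact h₃

theorem homEquiv_refl (q : CQ) : HomEquiv q q := by
  have : IsHom q q Term.var := ⟨rfl, fun _ _ => rfl, (headHom_var q).2⟩
  exact ⟨⟨_, this⟩, ⟨_, this⟩⟩

theorem finite_edges (q : CQ) : (E(q.hypergraph)).Finite := by
  have : E(q.hypergraph) = (fun a : RelAtom Term => varsOf a.args) '' q.atoms := by
    ext e
    change (∃ a ∈ q.atoms, e = _) ↔ _
    simp [eq_comm]
  rw [this]
  exact q.atoms.finite_toSet.image _

/-- A query of bounded semantic fractional cover number has a homomorphically equivalent one with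
a fractional edge cover of bounded weight. -/
theorem exists_cover_of_semantic_le {q : CQ} {k : ℝ} (h : semantic rhoStar q ≤ k) :
    ∃ q', HomEquiv q' q ∧ ∃ x : Set ℕ → ℝ, IsFractionalEdgeCover q'.hypergraph x ∧
      ∑ᶠ e ∈ E(q'.hypergraph), x e < k + 1 := by
  have h₁ : sInf {r | ∃ q', HomEquiv q' q ∧ r = rhoStar q'} < k + 1 := lt_of_le_of_lt h (by simp)
  have hne : {r | ∃ q', HomEquiv q' q ∧ r = rhoStar q'}.Nonempty := ⟨_, q, homEquiv_refl q, rfl⟩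
  obtain ⟨_, ⟨q', hq', rfl⟩, hr⟩ := exists_lt_of_csInf_lt hne h₁
  refine ⟨q', hq', ?_⟩
  have hone : IsFractionalEdgeCover q'.hypergraph fun _ => 1 := by
    refine ⟨fun _ _ => zero_le_one, ?_⟩
    rintro v ⟨a, ha, hv⟩
    have hfin : {e | e ∈ E(q'.hypergraph) ∧ v ∈ e}.Finite :=
      (finite_edges q').subset fun e he => he.1
    rw [finsum_mem_eq_finite_toFinset_sum _ hfin]
    simp only [Finset.sum_const, nsmul_eq_mul, mul_one, Nat.one_le_cast]
    exact Finset.card_pos.2 ⟨varsOf a.args, hfin.mem_toFinset.2 ⟨⟨a, ha, rfl⟩, hv⟩⟩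
  have hne' : {w | ∃ x : Set ℕ → ℝ, IsFractionalEdgeCover q'.hypergraph x ∧
      w = ∑ᶠ e ∈ E(q'.hypergraph), x e}.Nonempty := ⟨_, _, hone, rfl⟩
  obtain ⟨_, ⟨x, hx, rfl⟩, hlt⟩ := exists_lt_of_csInf_lt hne' hr
  exact ⟨x, hx, hlt⟩

end CQ

/-! ### Correctness of the algorithm -/

namespace PolyTM

open Enc (enc)

theorem zipAll_iff {γ δ : Type} {r : γ → δ → Bool} {l : List γ} {l' : List δ} :
    zipAll r l l' = true ↔ List.Forall₂ (fun a b => r a b = true) l l' := by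
  induction l generalizing l' with
  | nil => cases l' <;> simp [zipAll]
  | cons a l ih => cases l' <;> simp [zipAll, ih]

theorem matchAtom_iff {a f : RelAtom Term} : matchAtom a f = true ↔
    a.rel = f.rel ∧ List.Forall₂ (fun t v => isVar t = true ∨ t = v) a.args f.args := by
  simp [matchAtom, zipAll_iff]

theorem compat_iff {F p : List (RelAtom Term)} :
    compat F p = true ↔ ∀ a ∈ p.tail, ∃ f ∈ F, matchAtom a f = true := by
  simp [compat]

@[simp] theorem isVar_var (x : ℕ) : isVar (.var x) = true := rfl

@[simp] theorem isVar_const (x : ℕ) : isVar (.const x) = false := rfl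

theorem eq_const_of_isVar {t : Term} (h : isVar t = false) : t = .const (t.eval id) := by
  cases t with
  | var x => simp at h
  | const c => rfl

theorem isVar_of_mem_valueList {L : List DBFact} {t : Term} (h : t ∈ valueList (factList L)) :
    isVar t = false := by
  simp only [valueList, factList, List.mem_flatMap, List.mem_map] at h
  obtain ⟨_, ⟨a, _, rfl⟩, ht⟩ := h
  obtain ⟨c, _, rfl⟩ := List.mem_map.1 ht
  rfl

theorem mem_varList {c : CQ} {t : Term} :
    t ∈ varList (atomList c) ↔ (∃ a ∈ c.body, t ∈ a.args) ∧ isVar t = true := by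
  simp [varList, atomList]

/-- Replace the terms of `W` by their values under `θ`. -/
def fill (W : List Term) (θ : Term → Term) (t : Term) : Term := if t ∈ W then θ t else t

theorem replaceTerm_fill {W : List Term} {θ θ' : Term → Term} {x u : Term} (hx : isVar x = true)
    (hW : ∀ t ∈ W, θ t = θ' t ∧ isVar (θ t) = false) (hu : x ∉ W → θ' x = u) (t : Term) :
    replaceTerm x u (fill W θ t) = fill (W ++ [x]) θ' t := by
  by_cases ht : t ∈ W
  · have : θ t ≠ x := fun h => by rw [← h, (hW t ht).2] at hx; cases hx
    have h' : decide (θ t = x) = false := by simpa using this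
    simp only [replaceTerm, fill, ht, if_true, h', List.mem_append, true_or, cond_false]
    exact (hW t ht).1
  · by_cases htx : t = x
    · subst htx
      simp [replaceTerm, fill, ht, hu ht]
    · simp [replaceTerm, fill, ht, htx]

/-- The partial instance of a query given by values for the variables in `W`. -/
def instantiate (W : List Term) (θ : Term → Term) (c : List (RelAtom Term)) :
    List (RelAtom Term) := c.map fun a => a.map (fill W θ)

theorem replaceAtoms_instantiate {W : List Term} {θ θ' : Term → Term} {x u : Term}
    (hx : isVar x = true) (hW : ∀ t ∈ W, θ t = θ' t ∧ isVar (θ t) = false)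
    (hu : x ∉ W → θ' x = u) (c : List (RelAtom Term)) :
    replaceAtoms x u (instantiate W θ c) = instantiate (W ++ [x]) θ' c := by
  simp only [replaceAtoms, instantiate, List.map_map]
  refine List.map_congr_left fun a _ => ?_
  simp only [Function.comp, RelAtom.map, List.map_map, RelAtom.mk.injEq, true_and]
  exact List.map_congr_left fun t _ => replaceTerm_fill hx hW hu t

theorem mem_nextRound {F : List (RelAtom Term)} {T : List (List (RelAtom Term))} {x : Term}
    {p : List (RelAtom Term)} : p ∈ nextRound F T x ↔
      (∃ p₀ ∈ T, ∃ u ∈ valueList F, replaceAtoms x u p₀ = p) ∧ compat F p = true := by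
  simp [nextRound]

theorem instances_succ {F c : List (RelAtom Term)} {n : ℕ} (hn : n < (varList c).length) :
    instances F c (n + 1) = nextRound F (instances F c n) (varList c)[n] := by
  simp only [instances]
  rw [List.take_succ_eq_append_getElem hn, List.foldl_append]
  rfl

theorem isVar_of_mem_varList {c : List (RelAtom Term)} {t : Term} (h : t ∈ varList c) :
    isVar t = true := (List.mem_filter.1 h).2

theorem nodup_instances (F c : List (RelAtom Term)) {n : ℕ} (hn : n ≤ (varList c).length) :
    (instances F c n).Nodup := by
  cases n with
  | zero => exact (List.nodup_singleton c).filter _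
  | succ n => rw [instances_succ hn]; exact nodup_dedupList _

theorem instantiate_nil (θ : Term → Term) (c : List (RelAtom Term)) : instantiate [] θ c = c := by
  have : fill [] θ = id := by funext t; simp [fill]
  simp [instantiate, this, RelAtom.map]

theorem exists_of_mem_instances {L : List DBFact} {c : List (RelAtom Term)} {n : ℕ}
    (hn : n ≤ (varList c).length) {p : List (RelAtom Term)}
    (hp : p ∈ instances (factList L) c n) : compat (factList L) p = true ∧ ∃ θ : Term → Term,
      (∀ t ∈ (varList c).take n, θ t ∈ valueList (factList L)) ∧
      p = instantiate ((varList c).take n) θ c := by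
  induction n generalizing p with
  | zero =>
    simp only [instances, List.take_zero, List.foldl_nil, List.mem_filter,
      List.mem_singleton] at hp
    exact ⟨hp.2, id, by simp, by simp [instantiate_nil, hp.1]⟩
  | succ n ih =>
    rw [instances_succ hn, mem_nextRound] at hp
    obtain ⟨⟨p₀, hp₀, u, hu, rfl⟩, hcomp⟩ := hp
    obtain ⟨-, θ, hθ, rfl⟩ := ih (Nat.le_of_succ_le hn) hp₀
    refine ⟨hcomp, fun t => if t ∈ (varList c).take n then θ t else u, ?_, ?_⟩
    · intro t _
      dsimp only
      split_ifs with h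
      · exact hθ t h
      · exact hu
    · rw [List.take_succ_eq_append_getElem hn]
      exact replaceAtoms_instantiate (isVar_of_mem_varList (List.getElem_mem hn))
        (fun t ht => ⟨by simp [ht], isVar_of_mem_valueList (hθ t ht)⟩) (fun h => by simp [h]) c

theorem instantiate_mem_instances {L : List DBFact} {c : List (RelAtom Term)} {θ : Term → Term}
    (hθ : ∀ t ∈ varList c, θ t ∈ valueList (factList L))
    (hcomp : ∀ n, compat (factList L) (instantiate ((varList c).take n) θ c) = true) {n : ℕ}
    (hn : n ≤ (varList c).length) :
    instantiate ((varList c).take n) θ c ∈ instances (factList L) c n := by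
  induction n with
  | zero =>
    have := hcomp 0
    rw [List.take_zero, instantiate_nil] at this ⊢
    simpa [instances] using this
  | succ n ih =>
    rw [instances_succ hn, mem_nextRound]
    refine ⟨⟨_, ih (Nat.le_of_succ_le hn), _, hθ _ (List.getElem_mem hn), ?_⟩, hcomp _⟩
    rw [List.take_succ_eq_append_getElem hn]
    exact replaceAtoms_instantiate (isVar_of_mem_varList (List.getElem_mem hn))
      (fun t ht => ⟨rfl, isVar_of_mem_valueList (hθ t (List.mem_of_mem_take ht))⟩) (fun _ => rfl) c

theorem fill_varList {c : CQ} {θ : Term → Term} {σ : ℕ → ℕ}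
    (h : ∀ t ∈ varList (atomList c), θ t = .const (t.eval σ)) {t : Term}
    (ht : t ∈ c.head ∨ ∃ a ∈ c.body, t ∈ a.args) :
    fill (varList (atomList c)) θ t = .const (t.eval σ) := by
  cases t with
  | const d =>
    have : Term.const d ∉ varList (atomList c) := fun h => by simpa using isVar_of_mem_varList h
    rw [fill, if_neg this]
    rfl
  | var x =>
    have : Term.var x ∈ varList (atomList c) := by
      rw [mem_varList]
      refine ⟨?_, rfl⟩
      rcases ht with ht | ht
      · exact c.safe x ht
      · exact ht
    rw [fill, if_pos this, h _ this]

/-- The algorithm computes the answer of the query. -/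
theorem mem_answerList (c : CQ) (L : List DBFact) (ts : List Term) :
    ts ∈ answerList (factList L) (atomList c) ↔
      ∃ t ∈ c.answer L.toFinset, ts = t.map Term.const := by
  set W := varList (atomList c)
  have hheadD : ∀ θ, ((instantiate W θ (atomList c)).headD default).args =
      c.head.map (fill W θ) := fun θ => rfl
  simp only [answerList, mem_dedupList, List.mem_map]
  constructor
  · rintro ⟨p, hp, rfl⟩
    obtain ⟨hcomp, θ, hθ, rfl⟩ := exists_of_mem_instances le_rfl hp
    rw [List.take_length] at hθ hcomp ⊢
    let σ : ℕ → ℕ := fun x => (θ (.var x)).eval id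
    have hσ : ∀ t ∈ W, θ t = .const (t.eval σ) := by
      intro t ht
      have h := eq_const_of_isVar (isVar_of_mem_valueList (hθ t ht))
      cases t with
      | var x => exact h
      | const d => simpa using isVar_of_mem_varList ht
    have hat : ∀ a ∈ c.atoms, a.map (Term.eval σ) ∈ L.toFinset := by
      intro a ha
      have ha : a ∈ c.body := List.mem_toFinset.1 ha
      obtain ⟨f, hf, hm⟩ := compat_iff.1 hcomp (a.map (fill W θ)) (List.mem_map_of_mem ha)
      obtain ⟨b, hb, rfl⟩ := List.mem_map.1 hf
      obtain ⟨hrel, hargs⟩ := matchAtom_iff.1 hm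
      have h₁ : (a.map (fill W θ)).args = (a.args.map (Term.eval σ)).map Term.const := by
        simp only [RelAtom.map, List.map_map]
        exact List.map_congr_left fun t ht => fill_varList hσ (.inr ⟨a, ha, ht⟩)
      rw [h₁] at hargs
      have h₂ : (a.args.map (Term.eval σ)).map Term.const = b.args.map Term.const := by
        rw [← List.forall₂_eq_eq_eq]
        simp only [RelAtom.map, List.forall₂_map_left_iff, List.forall₂_map_right_iff] at hargs ⊢
        exact hargs.imp fun t v h => h.resolve_left (by simp)
      have h₃ := List.map_injective_iff.2 (fun _ _ h => Term.const.inj h) h₂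
      rw [List.mem_toFinset]
      have : a.map (Term.eval σ) = b := by
        rcases b with ⟨r, l⟩
        simp only [RelAtom.map, RelAtom.mk.injEq]
        exact ⟨hrel, h₃⟩
      rwa [this]
    refine ⟨c.head.map (Term.eval σ), ⟨σ, ?_, hat, rfl⟩, ?_⟩
    · rintro x ⟨a, ha, hx⟩
      exact ⟨_, hat a ha, List.mem_map.2 ⟨_, hx, rfl⟩⟩
    · rw [hheadD, List.map_map]
      exact List.map_congr_left fun t ht => fill_varList hσ (.inl ht)
  · rintro ⟨_, ⟨σ, -, hσ, rfl⟩, rfl⟩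
    let θ : Term → Term := fun t => .const (t.eval σ)
    have hmem : ∀ a ∈ c.body, (a.map (Term.eval σ)).map Term.const ∈ factList L := fun a ha =>
      List.mem_map_of_mem (List.mem_toFinset.1 (hσ a (List.mem_toFinset.2 ha)))
    have h := instantiate_mem_instances (L := L) (c := atomList c) (θ := θ) ?_ ?_ le_rfl
    · refine ⟨_, h, ?_⟩
      rw [List.take_length, hheadD, List.map_map]
      exact List.map_congr_left fun t ht => fill_varList (fun _ _ => rfl) (.inl ht)
    · intro t ht
      obtain ⟨⟨a, ha, hta⟩, -⟩ := mem_varList.1 ht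
      refine List.mem_flatMap.2 ⟨_, hmem a ha, ?_⟩
      exact List.mem_map.2 ⟨_, List.mem_map.2 ⟨t, hta, rfl⟩, rfl⟩
    · intro n
      rw [compat_iff]
      intro b hb
      obtain ⟨a, ha, rfl⟩ : ∃ a ∈ c.body, a.map (fill _ θ) = b := List.mem_map.1 hb
      refine ⟨_, hmem a ha, matchAtom_iff.2 ⟨rfl, ?_⟩⟩
      simp only [RelAtom.map, List.forall₂_map_left_iff, List.forall₂_map_right_iff]
      rw [List.forall₂_same]
      intro t _
      unfold fill
      split_ifs with ht
      · exact .inr rfl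
      · cases t with
        | var x => exact .inl rfl
        | const d => exact .inr rfl

/-! ### The number and size of the partial instances -/

theorem exists_common_of_forall₂ {R S : Type} {r : R → S → Prop} {T : Type} {f g : T → R}
    {l : List T} {m : List S} (hf : List.Forall₂ r (l.map f) m) (hg : List.Forall₂ r (l.map g) m)
    {t : T} (ht : t ∈ l) : ∃ v, r (f t) v ∧ r (g t) v := by
  induction l generalizing m with
  | nil => cases ht
  | cons a l ih =>
    cases hf with
    | cons h₁ hf =>
      cases hg with
      | cons h₂ hg =>
        rcases List.mem_cons.1 ht with rfl | ht
        · exact ⟨_, h₁, h₂⟩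
        · exact ih hf hg ht

/-- The number of compatible partial instances of a core is polynomial in the number of facts. A
fractional edge cover of a query `q'` with homomorphisms `f` from the core and `g` back, `g` being
a left inverse of `f`, covers the variables of the core: an edge `e` of `q'` covers the variables
that `f` maps into `e`. They occur together in one atom of the core, so that a single fact
determines their values. -/
theorem length_instances_le {c q : CQ} (hc : c.IsCore q) {k : ℝ}
    (hk : CQ.semantic CQ.rhoStar q ≤ k) (L : List DBFact) {n : ℕ}
    (hn : n ≤ (varList (atomList c)).length) :
    (instances (factList L) (atomList c) n).length ≤ (L.length + 1) ^ ⌈k + 1⌉₊ := by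
  classical
  obtain ⟨q', hq', x, hx, hxk⟩ := CQ.exists_cover_of_semantic_le hk
  obtain ⟨f, g, hf, hg, hfg⟩ := hc.exists_retract hq'
  set W := (varList (atomList c)).take n with hW
  set T := instances (factList L) (atomList c) n with hT
  have hT' := fun p (hp : p ∈ T) => exists_of_mem_instances hn hp
  choose! hcomp Θ hΘ hpΘ using hT'
  have hvar : ∀ t ∈ W, t = .var (t.eval id) := by
    intro t ht
    have := isVar_of_mem_varList (List.mem_of_mem_take ht)
    cases t with
    | var y => rfl
    | const d => simp at this
  let σ : List (RelAtom Term) → ℕ → ℕ := fun p y => (Θ p (.var y)).eval id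
  have hσ : ∀ p ∈ T, ∀ y, Term.var y ∈ W → Θ p (.var y) = .const (σ p y) := fun p hp y hy =>
    eq_const_of_isVar (isVar_of_mem_valueList (hΘ p hp _ hy))
  let V : Finset ℕ := (W.map (Term.eval id)).toFinset
  have hV : ∀ v ∈ V, Term.var v ∈ W := by
    intro v hv
    obtain ⟨t, ht, rfl⟩ := List.mem_map.1 (List.mem_toFinset.1 hv)
    rw [← hvar t ht]
    exact ht
  have hVc : ∀ v ∈ V, v ∈ c.vars := by
    intro v hv
    obtain ⟨⟨a, ha, hva⟩, -⟩ := mem_varList.1 (List.mem_of_mem_take (hV v hv))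
    exact ⟨a, List.mem_toFinset.2 ha, hva⟩
  let J : Finset (ℕ → ℕ) := T.toFinset.image σ
  let E : Finset (Set ℕ) := (CQ.finite_edges q').toFinset
  let S : Set ℕ → Finset ℕ := fun e => V.filter fun v => ∃ y ∈ e, f v = .var y
  -- an instance is determined by the values of its variables
  have h₁ : T.length ≤ numRestrict J V := by
    rw [← List.toFinset_card_of_nodup (nodup_instances _ _ hn)]
    unfold numRestrict
    rw [Finset.image_image]
    refine le_of_eq (Eq.trans ?_ (congrArg Finset.card (by congr)))
    refine (Finset.card_image_of_injOn (f := restrict V ∘ σ) ?_).symm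
    intro p hp p' hp' h
    have hp : p ∈ T := by simpa using hp
    have hp' : p' ∈ T := by simpa using hp'
    have h := restrict_eq_iff.1 h
    rw [hpΘ p hp, hpΘ p' hp']
    refine List.map_congr_left fun a _ => RelAtom.map_congr fun t _ => ?_
    unfold fill
    split_ifs with ht
    · have hv : t.eval id ∈ V := List.mem_toFinset.2 (List.mem_map_of_mem ht)
      rw [hvar t ht, hσ p hp _ (hvar t ht ▸ ht), hσ p' hp' _ (hvar t ht ▸ ht), h _ hv]
    · rfl
  -- the restriction to the variables covered by an edge is determined by a fact
  have h₂ : ∀ e ∈ E, numRestrict J (S e ∩ V) ≤ L.length + 1 := by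
    intro e he
    obtain ⟨a', ha', rfl⟩ := (CQ.finite_edges q').mem_toFinset.1 he
    have hb := hg a' ha'
    set b := a'.map (Term.subst g)
    have hbv : ∀ v ∈ S (varsOf a'.args) ∩ V, Term.var v ∈ b.args := by
      intro v hv
      obtain ⟨hvV, y, hy, hfy⟩ := Finset.mem_filter.1 (Finset.mem_inter.1 hv).1
      have := hfg v (hVc v hvV)
      rw [hfy] at this
      exact List.mem_map.2 ⟨_, hy, this⟩
    refine le_trans ?_ (Nat.le_succ_of_le
      (((factList L).toFinset_card_le).trans (by simp [factList])))
    unfold numRestrict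
    refine Finset.card_le_card_of_forall_subsingleton (fun η φ => ∃ p ∈ T,
      η = restrict (S (varsOf a'.args) ∩ V) (σ p) ∧ matchAtom (b.map (fill W (Θ p))) φ = true)
      ?_ ?_
    · intro η hη
      obtain ⟨τ, hτ, rfl⟩ := Finset.mem_image.1 hη
      obtain ⟨p, hp, rfl⟩ := Finset.mem_image.1 hτ
      have hp : p ∈ T := by simpa using hp
      have hcp := hcomp p hp
      rw [hpΘ p hp, compat_iff] at hcp
      obtain ⟨φ, hφ, hm⟩ := hcp (b.map (fill W (Θ p)))
        (List.mem_map_of_mem (f := fun a => a.map (fill W (Θ p))) (List.mem_toFinset.1 hb))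
      exact ⟨φ, List.mem_toFinset.2 hφ, p, hp, rfl, hm⟩
    · rintro φ - η ⟨-, p, hp, rfl, hm⟩ η' ⟨-, p', hp', rfl, hm'⟩
      rw [restrict_eq_iff]
      intro v hv
      have hvW := hV v (Finset.mem_inter.1 hv).2
      obtain ⟨u, hu, hu'⟩ := exists_common_of_forall₂ (matchAtom_iff.1 hm).2
        (matchAtom_iff.1 hm').2 (hbv v hv)
      rw [fill, if_pos hvW, hσ p hp v hvW] at hu
      rw [fill, if_pos hvW, hσ p' hp' v hvW] at hu'
      have := (hu.resolve_left (by simp)).trans (hu'.resolve_left (by simp)).symm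
      exact Term.const.inj this
  have hx0 : ∀ e ∈ E, 0 ≤ x e := fun e he => hx.1 e ((CQ.finite_edges q').mem_toFinset.1 he)
  have h₃ : ∀ v ∈ V, 1 ≤ ∑ e ∈ E.filter (fun e => v ∈ S e), x e := by
    intro v hv
    obtain ⟨a, ha, hva⟩ := hVc v hv
    -- `f v` is a variable, for `g` maps it back to the variable `v`
    obtain ⟨y, hy⟩ : ∃ y, f v = .var y := by
      have := hfg v (hVc v hv)
      cases h : f v with
      | var y => exact ⟨y, rfl⟩
      | const d => rw [h] at this; cases this
    have hyq : y ∈ q'.vars :=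
      ⟨_, hf a ha, List.mem_map.2 ⟨_, hva, hy⟩⟩
    have hfin : {e | e ∈ E(q'.hypergraph) ∧ y ∈ e}.Finite :=
      (CQ.finite_edges q').subset fun e he => he.1
    have h := hx.2 y hyq
    rw [finsum_mem_eq_finite_toFinset_sum _ hfin] at h
    convert h using 2
    ext e
    simp only [Finset.mem_filter, Set.Finite.mem_toFinset, Set.mem_ofPred_eq, E, S]
    refine and_congr_right fun _ => ⟨?_, fun h => ⟨hv, y, h, hy⟩⟩
    rintro ⟨-, z, hz, hfz⟩
    cases hy.symm.trans hfz
    exact hz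
  have h₄ : (T.length : ℝ) ≤ ((L.length + 1 : ℕ) : ℝ) ^ (⌈k + 1⌉₊ : ℝ) := by
    have hpos : (0 : ℝ) < ((L.length + 1 : ℕ) : ℝ) := by positivity
    calc (T.length : ℝ) ≤ numRestrict J V := by exact_mod_cast h₁
      _ ≤ ∏ e ∈ E, (numRestrict J (S e ∩ V) : ℝ) ^ x e := numRestrict_le_prod E S x hx0 V h₃ J
      _ ≤ ∏ e ∈ E, ((L.length + 1 : ℕ) : ℝ) ^ x e :=
          Finset.prod_le_prod (fun e _ => by positivity) fun e he =>
            Real.rpow_le_rpow (by positivity) (by exact_mod_cast h₂ e he) (hx0 e he)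
      _ = ((L.length + 1 : ℕ) : ℝ) ^ ∑ e ∈ E, x e := (Real.rpow_sum_of_pos hpos _ _).symm
      _ ≤ _ := by
          refine Real.rpow_le_rpow_of_exponent_le (by simp) ?_
          rw [finsum_mem_eq_finite_toFinset_sum _ (CQ.finite_edges q')] at hxk
          exact hxk.le.trans (Nat.le_ceil _)
  rw [Real.rpow_natCast] at h₄
  exact_mod_cast h₄

theorem size_map_le {α β : Type} [Enc α] [Enc β] {f : α → β} {l : List α} {m : ℕ} (hm : 1 ≤ m)
    (h : ∀ t ∈ l, size (f t) ≤ size t * m) : size (l.map f) ≤ size l * m := by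
  induction l with
  | nil => simp
  | cons t l ih =>
    have h₁ := ih fun t ht => h t (by simp [ht])
    have h₂ := h t (by simp)
    simp only [List.map_cons, size_cons, add_mul]
    omega

theorem size_relAtom {T : Type} [Enc T] (a : RelAtom T) : size a = size a.rel + size a.args :=
  size_pair a.rel a.args

theorem one_le_size_term (t : Term) : 1 ≤ size t := by
  change 1 ≤ size ((termPair t).1, (termPair t).2)
  rw [size_pair, size_bool]
  omega

theorem size_instantiate_le {W : List Term} {θ : Term → Term} {U : List Term}
    (hθ : ∀ t ∈ W, θ t ∈ U) (c : List (RelAtom Term)) :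
    size (instantiate W θ c) ≤ size c * (size U + 1) := by
  refine size_map_le (by omega) fun a _ => ?_
  have : size (a.args.map (fill W θ)) ≤ size a.args * (size U + 1) := by
    refine size_map_le (by omega) fun t _ => ?_
    unfold fill
    split_ifs with ht
    · have := size_le_of_mem (hθ t ht)
      have := Nat.mul_le_mul_right (size U + 1) (one_le_size_term t)
      omega
    · exact Nat.le_mul_of_pos_right _ (by omega)
  rw [size_relAtom, size_relAtom, add_mul]
  exact add_le_add (Nat.le_mul_of_pos_right _ (by omega)) this

theorem size_instances_le {c q : CQ} (hc : c.IsCore q) {k : ℝ}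
    (hk : CQ.semantic CQ.rhoStar q ≤ k) (L : List DBFact) {n : ℕ}
    (hn : n ≤ (varList (atomList c)).length) :
    size (instances (factList L) (atomList c) n) ≤ (size (factList L) + 1) ^ ⌈k + 1⌉₊ *
      (size (atomList c) * (size (valueList (factList L)) + 1) + 1) := by
  refine size_le_mul ((length_instances_le hc hk L hn).trans (Nat.pow_le_pow_left ?_ _)) ?_
  · have := length_le_size (factList L)
    rw [factList, List.length_map] at this
    exact Nat.succ_le_succ this
  · intro p hp
    obtain ⟨-, θ, hθ, rfl⟩ := exists_of_mem_instances hn hp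
    exact size_instantiate_le hθ _

/-! ### Evaluation of queries by way of their cores -/

theorem PT.encCQ_of_encInput {ι : Type} (q : ι → CQ) (L : ι → List DBFact) :
    PT (fun i => encInput (q i) (L i)) fun i => encCQ (q i) := by
  have := PT.transduce (splitStep false) (fun _ => []) false fun i => encInput (q i) (L i)
  have h : ∀ i, PolyTM.transduce (splitStep false) (fun _ => []) false (encInput (q i) (L i)) =
    encCQ (q i) := fun i => transduce_splitStep false _ _ (sep_notMem_encCQ _)
  simp only [h] at this
  exact this

theorem PT.encFacts_of_encInput {ι : Type} (q : ι → CQ) (L : ι → List DBFact) :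
    PT (fun i => encInput (q i) (L i)) fun i => encFacts (L i) := by
  have := PT.transduce (splitStep true) (fun _ => []) false fun i => encInput (q i) (L i)
  have h : ∀ i, PolyTM.transduce (splitStep true) (fun _ => []) false (encInput (q i) (L i)) =
    encFacts (L i) := fun i => transduce_splitStep true _ _ (sep_notMem_encCQ _)
  simp only [h] at this
  exact this

theorem PT.answerList {ι : Type} {q c : ι → CQ} {L : ι → List DBFact} {k : ℝ}
    (hc : ∀ i, (c i).IsCore (q i)) (hk : ∀ i, CQ.semantic CQ.rhoStar (q i) ≤ k)
    (hcore : PT (fun i => encCQ (q i)) fun i => encCQ (c i)) :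
    PT (fun i => encInput (q i) (L i)) fun i =>
      (answerList (factList (L i)) (atomList (c i))).flatMap encTerms := by
  have h₁ : PT (fun i => encInput (q i) (L i)) fun i => enc (atomList (c i)) := by
    have := (PT.encCQ_of_encInput q L).comp hcore
    simp only [encCQ_eq (c _)] at this
    exact this.comp (PT.parse _)
  have h₂ : PT (fun i => encInput (q i) (L i)) fun i => enc (factList (L i)) := by
    have := PT.encFacts_of_encInput q L
    simp only [encFacts_eq] at this
    exact this.comp (PT.parse _)
  have h₃ : PT (fun i => encInput (q i) (L i)) fun i => enc (atomList (c i), factList (L i)) :=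
    h₁.pair h₂
  have e := CP.id fun i => (atomList (c i), factList (L i))
  have hb : PolyBdd (fun i => size (atomList (c i), factList (L i))) fun i =>
      (size (factList (L i)) + 1) ^ ⌈k + 1⌉₊ *
        (size (atomList (c i)) * (size (valueList (factList (L i))) + 1) + 1) :=
    ((e.snd.size_le.add (.const _ 1)).pow _).mul
      ((e.fst.size_le.mul (e.snd.valueList.size_le.add (.const _ 1))).add (.const _ 1))
  have h₄ := CP.answerList hb fun i n hn => size_instances_le (hc i) (hk i) (L i) hn
  exact (h₃.comp h₄).comp (PT.print _)

theorem map_eval_map_const (t : List ℕ) : (t.map Term.const).map (Term.eval id) = t := by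
  simp [Function.comp_def, Term.eval]

end PolyTM

theorem mainTheorem6 (Q : Set CQ) (hcore : CoresComputableInPolyTime Q)
    (hbounded : ∃ k : ℝ, ∀ q ∈ Q, CQ.semantic CQ.rhoStar q ≤ k) :
    EvaluableInPolyTime Q := by
  obtain ⟨core, hcore, ⟨M⟩⟩ := hcore
  obtain ⟨k, hk⟩ := hbounded
  let A : Q × List DBFact → List (List Term) := fun p =>
    PolyTM.answerList (PolyTM.factList p.2) (PolyTM.atomList (core p.1))
  have hA : ∀ p, ∀ ts ∈ A p, (ts.map (Term.eval id)).map Term.const = ts := by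
    intro p ts hts
    obtain ⟨t, -, rfl⟩ := (PolyTM.mem_answerList _ _ _).1 hts
    rw [PolyTM.map_eval_map_const]
  refine ⟨fun p => (A p).map fun ts => ts.map (Term.eval id), fun p => ⟨?_, fun t => ?_⟩, ?_⟩
  · refine List.Nodup.map_on (fun ts hts ts' hts' h => ?_) (PolyTM.nodup_dedupList _)
    rw [← hA p ts hts, h, hA p ts' hts']
  · rw [← (hcore p.1).1 p.2.toFinset, List.mem_map]
    constructor
    · rintro ⟨ts, hts, rfl⟩
      obtain ⟨t, ht, rfl⟩ := (PolyTM.mem_answerList _ _ _).1 hts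
      rwa [PolyTM.map_eval_map_const]
    · intro ht
      refine ⟨t.map Term.const, (PolyTM.mem_answerList _ _ _).2 ⟨t, ht, rfl⟩,
        PolyTM.map_eval_map_const t⟩
  · refine PolyTM.PT.computable ?_
    have h := PolyTM.PT.answerList (q := fun p : Q × List DBFact => (p.1 : CQ))
      (c := fun p => core p.1) (L := fun p => p.2) (fun p => hcore p.1)
      (fun p => hk p.1 p.1.2) ((PolyTM.PT.of_computable M).reindex Prod.fst)
    have henc : ∀ p, encRelation ((A p).map fun ts => ts.map (Term.eval id)) =
        (A p).flatMap encTerms := by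
      intro p
      simp only [encRelation, List.flatMap_map]
      exact List.flatMap_congr fun ts hts => congrArg encTerms (hA p ts hts)
    simp only [henc]
    exact h
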